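/- Let $G$ be a locally compact (Hausdorff) group with a left Haar measure, and let all function spaces be real. Identify $L^\infty(G)$ with the dual of the convolution algebra $L^1(G)$ via $\langle a,\varphi\rangle=\int_G a(g)\varphi(g)\,dg$; bounded continuous functions on $G$ are thereby regarded as elements of $L^\infty(G)$. For $\varphi\in L^\infty(G)=L^1(G)^*$ and $a\in L^1(G)$ let $(\varphi\cdot a)(b)=\varphi(a\star b)$, and for $f\in C_b(G)$ and $g\in G$ let $(f\cdot g)(x)=f(gx)$. Let $B$ be the closed unit ball of $L^1(G)$, $\varphi\cdot B=\{\varphi\cdot a: a\in B\}$ and $f\cdot G=\{f\cdot g: g\in G\}$. A set $F$ of real functions on a set $K$ has the double limit property (DLP) if for all sequences $(f_n)$ in $F$ and $(x_m)$ in $K$, $\lim_n\lim_m f_n(x_m)=\lim_m\lim_n f_n(x_m)$ whenever both iterated limits exist. A bounded subset $S$ of a Banach space $E$ is $[\mathrm{DLP}]$-small if for every equicontinuous weak-star compact $M\subseteq E^*$, $S$ has the DLP as a family of functions on $M$. Put: - $\mathrm{WAP}(L^1(G))$: the set of $\varphi\in L^\infty(G)$ such that $\varphi\cdot B$ is relatively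 weakly compact in $L^\infty(G)$; - $\mathcal{S}_a$ (the $[\mathrm{DLP}]$-small functionals): the set of $\varphi$ in the closed linear span of $L^\infty(G)\cdot L^1(G)$ such that $\varphi\cdot B$ is $[\mathrm{DLP}]$-small in $L^\infty(G)$; - $\mathcal{S}_g$ (the $[\mathrm{DLP}]$-small functions): the set of bounded right uniformly continuous functions $f$ on $G$ (for every $\varepsilon>0$ there is a neighbourhood $U$ of the identity with $|f(x)-f(y)|<\varepsilon$ whenever $xy^{-1}\in U$) such that $f\cdot G$ is $[\mathrm{DLP}]$-small in $L^\infty(G)$; - $\mathrm{WAP}(G)$: the set of $f\in C_b(G)$ such that $f\cdot G$ is relatively weakly compact in $C_b(G)$. Then, as subsets of $L^\infty(G)$, $$\mathrm{WAP}(L^1(G))=\mathcal{S}_a=\mathcal{S}_g=\mathrm{WAP}(G).$$ -/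

import Mathlib

open MeasureTheory Filter Topology
open scoped ENNReal BoundedContinuousFunction

noncomputable section

/-! ### Double limits, weak compactness, smallness -/

/-- Grothendieck's double limit property of a family `F` of real functions on a set `K`: whenever
both iterated limits of `f n (x m)` exist, they are equal. -/
def HasDLP {K : Type*} (F : Set (K → ℝ)) : Prop :=
  ∀ f : ℕ → K → ℝ, (∀ n, f n ∈ F) → ∀ (x : ℕ → K) (u v : ℕ → ℝ) (a b : ℝ),
    (∀ n, Tendsto (fun m => f n (x m)) atTop (𝓝 (u n))) → Tendsto u atTop (𝓝 a) →
    (∀ m, Tendsto (fun n => f n (x m)) atTop (𝓝 (v m))) → Tendsto v atTop (𝓝 b) →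
    a = b

/-- The bornological class `[DLP]`: for a compact space `K`, the bounded subsets of the Banach space
`C(K)` that have the double limit property as families of functions on `K`. -/
def dlpClass (K : Type*) [TopologicalSpace K] [CompactSpace K] : Set (Set C(K, ℝ)) :=
  {F | Bornology.IsBounded F ∧ HasDLP ((fun f : C(K, ℝ) => (f : K → ℝ)) '' F)}

section Normed

variable {E : Type*} [NormedAddCommGroup E] [NormedSpace ℝ E]

/-- The restriction operator `r : E → C(M)` for a set `M` of functionals with the weak-star
topology. -/
def restrictTo (M : Set (WeakDual ℝ E)) (x : E) : C(M, ℝ) where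
  toFun m := (m : WeakDual ℝ E) x
  continuous_toFun := (WeakDual.eval_continuous x).comp continuous_subtype_val

variable (E) in
/-- The bornology of `[DLP]`-small subsets of `E`: the bounded sets `B` whose restriction to every
equicontinuous weak-star compact set `M` of functionals belongs to the class `[DLP]` on `M`. -/
def dlpSmall : Set (Set E) :=
  {B | Bornology.IsBounded B ∧
    ∀ (M : Set (WeakDual ℝ E)) (hM : IsCompact M),
      Equicontinuous (fun (m : M) (x : E) => (m : WeakDual ℝ E) x) →
      letI : CompactSpace M := isCompact_iff_compactSpace.mp hM
      restrictTo M '' B ∈ dlpClass M}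

/-- Relative compactness in the weak topology. -/
def IsRelWeaklyCompact (S : Set E) : Prop :=
  IsCompact (closure (toWeakSpace ℝ E '' S))

end Normed

/-! ### Functionals on a Banach algebra

The multiplication `(a, b) ↦ a b` is given as a bounded bilinear map `m`. -/

section Algebra

variable {A : Type*} [NormedAddCommGroup A] [NormedSpace ℝ A]

/-- The right module action `φ · a` on the dual: `(φ · a)(b) = φ (a b)`. -/
def dualAct (m : A →L[ℝ] A →L[ℝ] A) (φ : StrongDual ℝ A) (a : A) : StrongDual ℝ A :=
  φ.comp (m a)

/-- The set `φ · B_A`, where `B_A` is the closed unit ball of `A`. -/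
def ballOrbit (m : A →L[ℝ] A →L[ℝ] A) (φ : StrongDual ℝ A) : Set (StrongDual ℝ A) :=
  dualAct m φ '' Metric.closedBall 0 1

/-- Weakly almost periodic functionals: `φ · B_A` is relatively weakly compact in the dual. -/
def wapFunctionals (m : A →L[ℝ] A →L[ℝ] A) : Set (StrongDual ℝ A) :=
  {φ | IsRelWeaklyCompact (ballOrbit m φ)}

/-- The right uniformly continuous functionals: the closed linear span of `A* · A`. -/
def rucFunctionals (m : A →L[ℝ] A →L[ℝ] A) : Submodule ℝ (StrongDual ℝ A) :=
  (Submodule.span ℝ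
    (Set.range fun p : StrongDual ℝ A × A => dualAct m p.1 p.2)).topologicalClosure

/-- The functionals `φ ∈ ruc(A)` that are (right) `𝓑`-small: `φ · B_A ∈ 𝓑`. -/
def algebraSmall (m : A →L[ℝ] A →L[ℝ] A) (𝓑 : Set (Set (StrongDual ℝ A))) :
    Set (StrongDual ℝ A) :=
  {φ | φ ∈ rucFunctionals m ∧ ballOrbit m φ ∈ 𝓑}

end Algebra

/-! ### Functions on a topological group -/

section Group

variable {G : Type*} [Group G] [TopologicalSpace G] [IsTopologicalGroup G]

/-- The right translate `f · g`, i.e. `(f · g)(x) = f (g x)`. -/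
def translateBCF (f : G →ᵇ ℝ) (g : G) : G →ᵇ ℝ :=
  f.compContinuous ⟨fun x => g * x, continuous_const_mul g⟩

/-- The orbit `f · G`. -/
def groupOrbit (f : G →ᵇ ℝ) : Set (G →ᵇ ℝ) :=
  Set.range (translateBCF f)

variable (G) in
/-- `WAP(G)`: the bounded continuous functions whose orbit `f · G` is relatively weakly compact. -/
def wapFunctions : Set (G →ᵇ ℝ) :=
  {f | IsRelWeaklyCompact (groupOrbit f)}

variable (G) in
/-- `RUC(G)`: the bounded functions that are uniformly continuous for the right uniformity, whose
basic entourages are `{(x, y) | x y⁻¹ ∈ U}` for `U` a neighbourhood of the identity. -/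
def rucFunctions : Set (G →ᵇ ℝ) :=
  {f | ∀ ε > 0, ∃ U ∈ 𝓝 (1 : G), ∀ x y : G, x * y⁻¹ ∈ U → |f x - f y| < ε}

end Group

/-! ### The group algebra `L¹(G)` and its dual `L^∞(G)` -/

section LocallyCompact

variable {G : Type*} [Group G] [TopologicalSpace G] [IsTopologicalGroup G] [LocallyCompactSpace G]
  [MeasurableSpace G] [BorelSpace G] (μ : Measure G) [μ.IsHaarMeasure] [μ.Regular]

/-- The left translate `h · b` of `b ∈ L¹(G)`, i.e. `(h · b)(x) = b (h⁻¹ x)`. -/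
def translateL1 (h : G) : Lp ℝ 1 μ →ₗᵢ[ℝ] Lp ℝ 1 μ :=
  Lp.compMeasurePreservingₗᵢ ℝ (fun x => h⁻¹ * x) (measurePreserving_mul_left μ h⁻¹)

theorem coeFn_translateL1 (h : G) (b : Lp ℝ 1 μ) :
    translateL1 μ h b =ᵐ[μ] fun x => b (h⁻¹ * x) :=
  Lp.coeFn_compMeasurePreserving b (measurePreserving_mul_left μ h⁻¹)

theorem continuous_translateL1 (b : Lp ℝ 1 μ) : Continuous fun h : G => translateL1 μ h b := by
  have hF : Continuous fun h : G => (⟨fun x => h⁻¹ * x, continuous_const_mul h⁻¹⟩ : C(G, G)) :=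
    ContinuousMap.continuous_of_continuous_uncurry _ (by
      change Continuous fun p : G × G => p.1⁻¹ * p.2
      fun_prop)
  exact (continuous_const (y := b)).compMeasurePreservingLp hF
    (fun h => measurePreserving_mul_left μ h⁻¹) ENNReal.one_ne_top

theorem aestronglyMeasurable_smul_of_continuous {E : Type*} [NormedAddCommGroup E]
    [NormedSpace ℝ E] (a : Lp ℝ 1 μ) {F : G → E} (hF : Continuous F) :
    AEStronglyMeasurable (fun h => a h • F h) μ := by
  have key : ∀ S : Set G, MeasurableSet S → μ S < ∞ →
      AEStronglyMeasurable F (μ.restrict S) := by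
    intro S hS hSμ
    have hx : ∀ n : ℕ, ∃ K, K ⊆ S ∧ IsCompact K ∧ IsClosed K ∧
        μ (S \ K) < ((n : ℝ≥0∞) + 1)⁻¹ := fun n =>
      hS.exists_isCompact_isClosed_sdiff_lt hSμ.ne (by simp)
    choose K hKS hK hKc hKμ using hx
    have hnull : μ (S \ ⋃ n, K n) = 0 := by
      have hlim : Tendsto (fun n : ℕ => (((n + 1 : ℕ) : ℝ≥0∞))⁻¹) atTop (𝓝 0) :=
        (tendsto_add_atTop_iff_nat 1).2 ENNReal.tendsto_inv_nat_nhds_zero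
      refine le_antisymm (ge_of_tendsto' hlim fun n => ?_) zero_le
      refine (measure_mono (Set.sdiff_subset_sdiff_right (Set.subset_iUnion K n))).trans ?_
      simpa using (hKμ n).le
    have heq : (⋃ n, K n : Set G) =ᵐ[μ] S :=
      (Set.iUnion_subset hKS).eventuallyLE.antisymm (ae_le_set.2 hnull)
    rw [← Measure.restrict_congr_set heq, aestronglyMeasurable_iUnion_iff]
    exact fun n => hF.continuousOn.aestronglyMeasurable_of_isCompact (hK n) (hKc n).measurableSet
  obtain ⟨s, hs, hlim⟩ := Lp.finStronglyMeasurable a one_ne_zero ENNReal.one_ne_top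
  refine aestronglyMeasurable_of_tendsto_ae atTop (f := fun n h => s n h • F h) (fun n => ?_)
    (Eventually.of_forall fun h => (hlim h).smul_const _)
  have hm : MeasurableSet (Function.support (s n)) := (s n).measurableSet_support
  have hind : (fun h => s n h • F h) =
      (Function.support (s n)).indicator (fun h => s n h • F h) := by
    refine (Set.indicator_eq_self.2 fun h hh => ?_).symm
    exact fun h0 => hh (by simp [h0])
  rw [hind, aestronglyMeasurable_indicator_iff hm]
  exact (s n).stronglyMeasurable.aestronglyMeasurable.smul (key _ hm (hs n))

theorem integrable_smul_translateL1 (a b : Lp ℝ 1 μ) :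
    Integrable (fun h => a h • translateL1 μ h b) μ := by
  refine ((L1.integrable_coeFn a).norm.mul_const ‖b‖).mono'
    (aestronglyMeasurable_smul_of_continuous μ a (continuous_translateL1 μ b))
    (Eventually.of_forall fun h => ?_)
  rw [norm_smul, LinearIsometry.norm_map]

/-- The convolution product of `L¹(G)`: `a ⋆ b = ∫ a(h) (h · b) dh`, that is
`(a ⋆ b)(g) = ∫ a(h) b(h⁻¹ g) dh`, as a bounded bilinear map. The integral is an integral of
functions with values in `L¹(G)`, and always converges. -/
def convolutionL1 : Lp ℝ 1 μ →L[ℝ] Lp ℝ 1 μ →L[ℝ] Lp ℝ 1 μ :=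
  LinearMap.mkContinuous₂
    (LinearMap.mk₂ ℝ (fun a b => ∫ h, a h • translateL1 μ h b ∂μ)
      (fun a a' b => by
        rw [← integral_add (integrable_smul_translateL1 μ a b)
          (integrable_smul_translateL1 μ a' b)]
        refine integral_congr_ae ?_
        filter_upwards [Lp.coeFn_add a a'] with h hh
        rw [hh, Pi.add_apply, add_smul])
      (fun c a b => by
        rw [← integral_smul]
        refine integral_congr_ae ?_
        filter_upwards [Lp.coeFn_smul c a] with h hh
        rw [hh, Pi.smul_apply, smul_assoc])
      (fun a b b' => by
        rw [← integral_add (integrable_smul_translateL1 μ a b)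
          (integrable_smul_translateL1 μ a b')]
        simp only [map_add, smul_add])
      (fun c a b => by
        rw [← integral_smul]
        simp only [map_smul, smul_comm c]))
    1 (fun a b => by
      rw [LinearMap.mk₂_apply, one_mul]
      refine (norm_integral_le_integral_norm _).trans (le_of_eq ?_)
      simp only [norm_smul, LinearIsometry.norm_map]
      rw [integral_mul_const, L1.norm_eq_integral_norm a])

/-- A bounded continuous function as an element of `L^∞(G)`, where `L^∞(G)` is the dual of `L¹(G)`:
`⟨a, f⟩ = ∫ a(g) f(g) dg`. -/
def toDual (f : G →ᵇ ℝ) : StrongDual ℝ (Lp ℝ 1 μ) :=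
  LinearMap.mkContinuous
    { toFun := fun a => ∫ g, a g * f g ∂μ
      map_add' := fun a b => by
        have hi : ∀ c : Lp ℝ 1 μ, Integrable (fun g => c g * f g) μ := fun c =>
          (L1.integrable_coeFn c).mul_bdd (c := ‖f‖) f.continuous.measurable.aestronglyMeasurable
            (Eventually.of_forall f.norm_coe_le_norm)
        rw [← integral_add (hi a) (hi b)]
        refine integral_congr_ae ?_
        filter_upwards [Lp.coeFn_add a b] with g hg
        rw [hg, Pi.add_apply, add_mul]
      map_smul' := fun c a => by
        rw [RingHom.id_apply, ← integral_smul]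
        refine integral_congr_ae ?_
        filter_upwards [Lp.coeFn_smul c a] with g hg
        rw [hg, Pi.smul_apply, smul_mul_assoc] }
    ‖f‖ (fun a => by
      change ‖∫ g, a g * f g ∂μ‖ ≤ ‖f‖ * ‖a‖
      rw [L1.norm_eq_integral_norm, ← integral_const_mul]
      refine norm_integral_le_of_norm_le ((L1.integrable_coeFn a).norm.const_mul _)
        (Eventually.of_forall fun g => ?_)
      rw [norm_mul, mul_comm]
      exact mul_le_mul_of_nonneg_right (f.norm_coe_le_norm g) (norm_nonneg _))

/-- The elements of `L^∞(G)` given by functions `f ∈ RUC(G)` that are (right) `𝓑`-small as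
functions: `f · G ∈ 𝓑`. -/
def groupSmall (𝓑 : Set (Set (StrongDual ℝ (Lp ℝ 1 μ)))) : Set (StrongDual ℝ (Lp ℝ 1 μ)) :=
  toDual μ '' {f | f ∈ rucFunctions G ∧ toDual μ '' groupOrbit f ∈ 𝓑}

end LocallyCompact

end

/-!
# Weakly almost periodic and `[DLP]`-small functionals on `L¹(G)`

By Grothendieck's double limit theorem (`dlpSmall_eq`), a subset of a Banach space is `[DLP]`-small
exactly when it is relatively weakly compact. The four sets of the theorem are thus described by weak
compactness of orbits, under `B` or under `G`, and by uniform continuity; it remains to compare the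
orbits and to derive the uniform continuity.

*From `B` to `G`.* Probability densities `e` concentrating at `x ∈ G` (`diracFilter`) satisfy
`e ⋆ b → δ_x ⋆ b` for `b ∈ L¹(G)`. So `φ · e → φ · x` in the weak-star topology, and the limit is a
weak one if `φ · B` is relatively weakly compact (`comp_translateL1_mem_closure`): the orbit under `G`
is contained in the weak closure of `φ · B`. For `x = 1` this says that `φ` is in the weak closure of
the `φ · e`. These lie in `L^∞(G) · L¹(G)`, and for `e ∈ C_c(G)` they are the right uniformly
continuous functions `x ↦ φ(e ⋆ δ_x)` (`dualAct_ccToL1_mem`). As norm closed subspaces are weakly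
closed, `φ` is in the closed span of `L^∞(G) · L¹(G)` and is given by a function in `RUC(G)`.

*From `G` to `B`.* If `f · G` is relatively weakly compact, then so is its convex hull, by Krein's
theorem (`IsRelWeaklyCompact.convexHull`), and the average `f · a = ∫ a(h) (f · h) dh` lies in the
closed convex hull of `± f · G` for `a ∈ B` (`toDual_mem_wapFunctionals`). No continuity of
`h ↦ f · h` is needed for this, so that the uniform continuity of functions in `WAP(G)` comes out of
the previous step.

*From `L^∞(G)` to `C_b(G)`.* The embedding `toDualLI` is isometric, and weak compactness can be
tested on either side of an isometric embedding (`IsRelWeaklyCompact.of_image`).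
-/

set_option linter.unusedSectionVars false

noncomputable section

open scoped CompactlySupported

/-! ### Grothendieck's double limit theorem -/

section WeakCompactness

variable {E : Type*} [NormedAddCommGroup E] [NormedSpace ℝ E]

theorem continuous_apply_toWeakSpace_symm (x : StrongDual ℝ E) :
    Continuous fun w : WeakSpace ℝ E => x ((toWeakSpace ℝ E).symm w) :=
  WeakBilin.eval_continuous (topDualPairing ℝ E).flip x

/-- If a functional `F` on `D` is arbitrarily small on the unit ball of the annihilators of finite
subsets of a Banach space `E` of functionals, then it belongs to `E`. -/
theorem mem_range_of_small_on_annihilators [CompleteSpace E] {D : Type*} [NormedAddCommGroup D]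
    [NormedSpace ℝ D] (J : E →ₗᵢ[ℝ] StrongDual ℝ D) (F : StrongDual ℝ D)
    (h : ∀ ε > 0, ∃ s : Finset E, ∀ x : D, ‖x‖ ≤ 1 → (∀ e ∈ s, J e x = 0) → |F x| ≤ ε) :
    F ∈ Set.range J := by
  rw [← J.isometry.isClosedEmbedding.isClosed_range.closure_eq, Metric.mem_closure_iff]
  intro ε hε
  obtain ⟨s, hs⟩ := h (ε / 2) (half_pos hε)
  let L : s → (D →ₗ[ℝ] ℝ) := fun e => (J (e : E)).toLinearMap
  let N : Submodule ℝ D := ⨅ e, LinearMap.ker (L e)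
  have hN : ∀ x ∈ N, ∀ e ∈ s, J e x = 0 := fun x hx e he =>
    (Submodule.mem_iInf _).1 hx ⟨e, he⟩
  -- `F'` has small norm, and `F - F'` vanishes on `N`, hence is a combination of the `J e`
  obtain ⟨F', hF', hnorm⟩ := exists_extension_norm_eq N (F.comp N.subtypeL)
  have hle : ‖F.comp N.subtypeL‖ ≤ ε / 2 :=
    ContinuousLinearMap.opNorm_le_of_unit_norm (by positivity) fun x hx =>
      hs x (le_of_eq hx) (hN x x.2)
  have hspan : (F - F').toLinearMap ∈ Submodule.span ℝ (Set.range L) := by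
    refine mem_span_of_iInf_ker_le_ker fun x hx => ?_
    have := hF' ⟨x, hx⟩
    simp at this
    simp [this]
  have hrange : Submodule.span ℝ (Set.range L) ≤
      LinearMap.range ((ContinuousLinearMap.coeLM ℝ).comp J.toLinearMap) := by
    rw [Submodule.span_le]
    rintro _ ⟨e, rfl⟩
    exact ⟨e, rfl⟩
  obtain ⟨e, he⟩ := hrange hspan
  have he' : J e = F - F' := by
    ext x; exact LinearMap.congr_fun he x
  refine ⟨_, ⟨e, rfl⟩, ?_⟩
  rw [he', dist_eq_norm, sub_sub_cancel, hnorm]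
  linarith

/-- The double limit property of a set of vectors against the unit ball of the dual. -/
def HasDualBallDLP (S : Set E) : Prop :=
  ∀ y : ℕ → E, (∀ n, y n ∈ S) → ∀ x : ℕ → StrongDual ℝ E, (∀ m, ‖x m‖ ≤ 1) →
    ∀ (u v : ℕ → ℝ) (a b : ℝ),
    (∀ n, Tendsto (fun m => x m (y n)) atTop (𝓝 (u n))) → Tendsto u atTop (𝓝 a) →
    (∀ m, Tendsto (fun n => x m (y n)) atTop (𝓝 (v m))) → Tendsto v atTop (𝓝 b) → a = b

/-- The hard half of **Grothendieck's double limit theorem**. If the weak-star closure of `S` in the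
bidual contained some `F` outside `E`, one could choose alternately points of `S` approximating `F`
and functionals, with values under `F` bounded away from `0`, that vanish on the points chosen
before them; the iterated limits would then be zero and nonzero. -/
theorem HasDualBallDLP.isRelWeaklyCompact [CompleteSpace E] {S : Set E}
    (hb : Bornology.IsBounded S) (hS : HasDualBallDLP S) : IsRelWeaklyCompact S := by
  refine NormedSpace.isCompact_closure_of_isBounded ℝ E _ ?_ ?_
  · rwa [Set.preimage_image_eq _ (toWeakSpace ℝ E).injective]
  intro F hF
  by_contra hne
  have hF0 : ¬ ∀ ε > 0, ∃ s : Finset E, ∀ x : StrongDual ℝ E, ‖x‖ ≤ 1 → (∀ e ∈ s, x e = 0) →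
      |(F : StrongDual ℝ E → ℝ) x| ≤ ε := by
    intro h
    obtain ⟨e, he⟩ := mem_range_of_small_on_annihilators
      (NormedSpace.inclusionInDoubleDualLi (E := E) ℝ) (WeakDual.toStrongDual F) h
    exact hne ⟨toWeakSpace ℝ E e, congrArg StrongDual.toWeakDual he⟩
  push Not at hF0
  obtain ⟨ε, hε, hX⟩ := hF0
  choose X hX1 hX0 hXε using hX
  -- points of `S` approximate `F` on finitely many functionals
  have happ : ∀ (t : Finset (StrongDual ℝ E)) (δ : ℝ), 0 < δ →
      ∃ y ∈ S, ∀ x ∈ t, |x y - F x| < δ := by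
    intro t δ hδ
    have ho : IsOpen {Φ : WeakDual ℝ (StrongDual ℝ E) | ∀ x ∈ t, |Φ x - F x| < δ} := by
      have : {Φ : WeakDual ℝ (StrongDual ℝ E) | ∀ x ∈ t, |Φ x - F x| < δ} =
          ⋂ x ∈ t, {Φ : WeakDual ℝ (StrongDual ℝ E) | |Φ x - F x| < δ} := by
        ext; simp
      rw [this]
      refine isOpen_biInter_finset fun x _ => ?_
      exact isOpen_lt (((WeakDual.eval_continuous x).sub continuous_const).abs) continuous_const
    obtain ⟨_, hΦ, _, ⟨y, hy, rfl⟩, rfl⟩ := mem_closure_iff.1 hF _ ho (by simpa using fun _ _ => hδ)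
    exact ⟨y, hy, fun x hx => hΦ x hx⟩
  classical
  obtain ⟨z, hz, hzr⟩ := exists_seq_of_forall_finset_exists
    (α := E × StrongDual ℝ E × ℕ)
    (fun p => p.1 ∈ S ∧ ‖p.2.1‖ ≤ 1 ∧ ε < |F p.2.1|)
    (fun p q => |p.2.1 q.1 - F p.2.1| < 1 / ((q.2.2 : ℝ) + 1) ∧ q.2.1 p.1 = 0 ∧ p.2.2 < q.2.2)
    (by
      intro s _
      obtain ⟨k, hk⟩ : ∃ k, ∀ p ∈ s, p.2.2 < k :=
        ⟨s.sup (fun p => p.2.2) + 1, fun p hp =>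
          Nat.lt_succ_of_le (Finset.le_sup (f := fun p => p.2.2) hp)⟩
      obtain ⟨y, hy, hyt⟩ := happ (s.image fun p => p.2.1) (1 / ((k : ℝ) + 1)) (by positivity)
      refine ⟨(y, X (s.image fun p => p.1), k), ⟨hy, hX1 _, hXε _⟩, fun p hp => ⟨?_, ?_, hk p hp⟩⟩
      · exact hyt _ (Finset.mem_image_of_mem _ hp)
      · exact hX0 _ _ (Finset.mem_image_of_mem _ hp))
  have hmono : StrictMono fun n => (z n).2.2 := strictMono_nat_of_lt_succ fun n =>
    (hzr n (n + 1) n.lt_succ_self).2.2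
  -- the limit in `n` of `x m (y n)` is `F (x m)`
  have hlim : ∀ m, Tendsto (fun n => (z m).2.1 (z n).1) atTop (𝓝 (F (z m).2.1)) := by
    intro m
    rw [tendsto_iff_dist_tendsto_zero]
    refine squeeze_zero' (Eventually.of_forall fun _ => dist_nonneg) ?_
      tendsto_one_div_add_atTop_nhds_zero_nat
    filter_upwards [eventually_gt_atTop m] with n hn
    rw [Real.dist_eq]
    refine (hzr m n hn).1.le.trans ?_
    have : (n : ℝ) ≤ ((z n).2.2 : ℝ) := by exact_mod_cast hmono.le_apply
    gcongr
  have hFb : ∀ m, F (z m).2.1 ∈ Metric.closedBall (0 : ℝ) ‖WeakDual.toStrongDual F‖ := by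
    intro m
    rw [mem_closedBall_zero_iff]
    exact ((WeakDual.toStrongDual F).le_opNorm _).trans
      (mul_le_of_le_one_right (norm_nonneg _) (hz m).2.1)
  obtain ⟨b, -, ψ, hψ, hb'⟩ := (isCompact_closedBall _ _).tendsto_subseq hFb
  have h0 : (0 : ℝ) = b := by
    refine hS (fun n => (z n).1) (fun n => (hz n).1) (fun m => (z (ψ m)).2.1)
      (fun m => (hz _).2.1) (fun _ => 0) (fun m => F (z (ψ m)).2.1) 0 b ?_ tendsto_const_nhds
      (fun m => hlim _) hb'
    intro n
    refine tendsto_const_nhds.congr' ?_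
    filter_upwards [hψ.tendsto_atTop.eventually_gt_atTop n] with m hm
    exact ((hzr n (ψ m) hm).2.1).symm
  have : ε ≤ |b| := ge_of_tendsto' hb'.abs fun m => (hz _).2.2.le
  rw [← h0, abs_zero] at this
  linarith

theorem IsRelWeaklyCompact.isBounded {S : Set E} (hS : IsRelWeaklyCompact S) :
    Bornology.IsBounded S := by
  obtain ⟨C, hC⟩ := banach_steinhaus (ι := S)
    (g := fun s => NormedSpace.inclusionInDoubleDual ℝ E (s : E)) (by
      intro x
      obtain ⟨C, hC⟩ := (hS.image (continuous_apply_toWeakSpace_symm x)).isBounded.exists_norm_le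
      exact ⟨C, fun s => hC _ ⟨_, subset_closure ⟨s, s.2, rfl⟩, rfl⟩⟩)
  rw [isBounded_iff_forall_norm_le]
  refine ⟨C, fun s hs => ?_⟩
  rw [← (NormedSpace.inclusionInDoubleDualLi (E := E) ℝ).norm_map s]
  exact hC ⟨s, hs⟩

theorem IsRelWeaklyCompact.mono {S T : Set E} (hT : IsRelWeaklyCompact T) (h : S ⊆ T) :
    IsRelWeaklyCompact S :=
  hT.of_isClosed_subset isClosed_closure (closure_mono (Set.image_mono h))

/-- The easy half of Grothendieck's theorem: along an ultrafilter the two sequences converge to some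
`w` and `ξ`, and both iterated limits equal `ξ w`. -/
theorem IsRelWeaklyCompact.eq_of_tendsto {S : Set E} (hS : IsRelWeaklyCompact S)
    {M : Set (WeakDual ℝ E)} (hM : IsCompact M) {y : ℕ → E} (hy : ∀ n, y n ∈ S)
    {x : ℕ → WeakDual ℝ E} (hx : ∀ m, x m ∈ M) {u v : ℕ → ℝ} {a b : ℝ}
    (hu : ∀ n, Tendsto (fun m => x m (y n)) atTop (𝓝 (u n))) (ha : Tendsto u atTop (𝓝 a))
    (hv : ∀ m, Tendsto (fun n => x m (y n)) atTop (𝓝 (v m))) (hb : Tendsto v atTop (𝓝 b)) :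
    a = b := by
  let 𝒰 : Ultrafilter ℕ := hyperfilter ℕ
  have h𝒰 : (𝒰 : Filter ℕ) ≤ atTop := Nat.hyperfilter_le_atTop
  obtain ⟨w, -, hw⟩ := hS.ultrafilter_le_nhds (𝒰.map fun n => toWeakSpace ℝ E (y n))
    (le_principal_iff.2 (Ultrafilter.mem_coe.2 <| Ultrafilter.mem_map.2 <| univ_mem' fun n =>
      subset_closure ⟨y n, hy n, rfl⟩))
  obtain ⟨ξ, -, hξ⟩ := hM.ultrafilter_le_nhds (𝒰.map x)
    (le_principal_iff.2 (Ultrafilter.mem_coe.2 <| Ultrafilter.mem_map.2 <| univ_mem' hx))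
  have hw' : ∀ f : StrongDual ℝ E,
      Tendsto (fun n => f (y n)) 𝒰 (𝓝 (f ((toWeakSpace ℝ E).symm w))) := fun f =>
    ((continuous_apply_toWeakSpace_symm f).tendsto w).comp (show Tendsto _ _ _ from hw)
  have hξ' : ∀ e : E, Tendsto (fun m => x m e) 𝒰 (𝓝 (ξ e)) := fun e =>
    ((WeakDual.eval_continuous e).tendsto ξ).comp (show Tendsto _ _ _ from hξ)
  have h1 : ∀ n, u n = ξ (y n) := fun n => tendsto_nhds_unique ((hu n).mono_left h𝒰) (hξ' _)
  have h2 : ∀ m, v m = x m ((toWeakSpace ℝ E).symm w) := fun m =>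
    tendsto_nhds_unique ((hv m).mono_left h𝒰) (hw' (WeakDual.toStrongDual (x m)))
  have h3 : a = ξ ((toWeakSpace ℝ E).symm w) :=
    tendsto_nhds_unique (ha.mono_left h𝒰)
      ((hw' (WeakDual.toStrongDual ξ)).congr fun n => (h1 n).symm)
  have h4 : b = ξ ((toWeakSpace ℝ E).symm w) :=
    tendsto_nhds_unique (hb.mono_left h𝒰) ((hξ' _).congr fun n => (h2 n).symm)
  rw [h3, h4]

theorem IsRelWeaklyCompact.hasDualBallDLP {S : Set E} (hS : IsRelWeaklyCompact S) :
    HasDualBallDLP S := fun _ hy x hx _ _ _ _ hu ha hv hb =>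
  hS.eq_of_tendsto (WeakDual.isCompact_closedBall (0 : StrongDual ℝ E) 1)
    hy (x := fun m => StrongDual.toWeakDual (x m))
    (fun m => mem_closedBall_zero_iff.2 (hx m)) hu ha hv hb

/-- **Grothendieck's double limit theorem**: in a Banach space the `[DLP]`-small sets are exactly the
relatively weakly compact ones. -/
theorem dlpSmall_eq [CompleteSpace E] : dlpSmall E = {S : Set E | IsRelWeaklyCompact S} := by
  ext S
  constructor
  · rintro ⟨hb, h⟩
    refine HasDualBallDLP.isRelWeaklyCompact hb fun y hy x hx u v a b hu ha hv hb => ?_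
    have hM := WeakDual.isCompact_closedBall (0 : StrongDual ℝ E) 1
    have heq : Equicontinuous fun
        (m : (WeakDual.toStrongDual ⁻¹' Metric.closedBall (0 : StrongDual ℝ E) 1 :
          Set (WeakDual ℝ E))) (e : E) => (m : WeakDual ℝ E) e := by
      have : ∀ m : (WeakDual.toStrongDual ⁻¹' Metric.closedBall (0 : StrongDual ℝ E) 1 :
          Set (WeakDual ℝ E)), LipschitzWith 1 fun e : E => (m : WeakDual ℝ E) e := fun m =>
        LipschitzWith.of_dist_le_mul fun e e' => by
          rw [dist_eq_norm, dist_eq_norm, ← map_sub]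
          refine (WeakDual.toStrongDual (m : WeakDual ℝ E)).le_of_opNorm_le ?_ _
          exact mem_closedBall_zero_iff.1 m.2
      exact (LipschitzWith.uniformEquicontinuous _ 1 this).equicontinuous
    have h2 := (h _ hM heq).2
    refine h2 (fun n m => (m : WeakDual ℝ E) (y n))
      (fun n => ⟨_, ⟨y n, hy n, rfl⟩, rfl⟩)
      (fun m => ⟨StrongDual.toWeakDual (x m), by simpa using hx m⟩) u v a b hu ha hv hb
  · intro hS
    refine ⟨hS.isBounded, fun M hM heq => ?_⟩
    have : CompactSpace M := isCompact_iff_compactSpace.mp hM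
    refine ⟨?_, ?_⟩
    · obtain ⟨C, hC⟩ := hS.isBounded.exists_norm_le
      have hev : ∀ᶠ e in 𝓝 (0 : E), ∀ m : M, dist ((m : WeakDual ℝ E) 0) ((m : WeakDual ℝ E) e) < 1 :=
        Metric.equicontinuousAt_iff_right.1 (heq 0) 1 one_pos
      obtain ⟨δ, hδ, hball⟩ := Metric.eventually_nhds_iff.1 hev
      rw [isBounded_iff_forall_norm_le]
      refine ⟨(|C| + 1) * (2 / δ), ?_⟩
      rintro _ ⟨e, he, rfl⟩
      rw [ContinuousMap.norm_le _ (by positivity)]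
      intro m
      have hc : (0 : ℝ) < (|C| + 1) * (2 / δ) := by positivity
      have hsm : dist (((|C| + 1) * (2 / δ))⁻¹ • e) 0 < δ := by
        rw [dist_zero_right, norm_smul, norm_inv, Real.norm_of_nonneg hc.le, inv_mul_lt_iff₀ hc]
        have := hC e he
        have h1 := le_abs_self C
        have : (|C| + 1) * (2 / δ) * δ = 2 * (|C| + 1) := by field_simp
        rw [this]; linarith [abs_nonneg C]
      have h3 := hball hsm m
      rw [map_zero, dist_zero_left, map_smul, norm_smul, norm_inv, Real.norm_of_nonneg hc.le,
        inv_mul_lt_iff₀ hc, mul_one] at h3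
      exact h3.le
    · intro f hf x u v a b hu ha hv hb
      choose g hg hgf using hf
      choose y hy hyg using hg
      have hfe : ∀ n m, f n m = (m : WeakDual ℝ E) (y n) := by
        intro n m; rw [← hgf, ← hyg]; rfl
      simp only [hfe] at hu hv
      exact hS.eq_of_tendsto hM hy (x := fun m => (x m : WeakDual ℝ E)) (fun m => (x m).2)
        hu ha hv hb

variable {F : Type*} [NormedAddCommGroup F] [NormedSpace ℝ F]

theorem IsRelWeaklyCompact.image {S : Set E} (hS : IsRelWeaklyCompact S) (T : E →L[ℝ] F) :
    IsRelWeaklyCompact (T '' S) := by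
  have hc : Continuous fun w : WeakSpace ℝ E => toWeakSpace ℝ F (T ((toWeakSpace ℝ E).symm w)) :=
    WeakBilin.continuous_of_continuous_eval _ fun x =>
      continuous_apply_toWeakSpace_symm (x.comp T)
  refine (IsCompact.image hS hc).of_isClosed_subset isClosed_closure
    (closure_minimal ?_ (IsCompact.image hS hc).isClosed)
  rintro _ ⟨_, ⟨s, hs, rfl⟩, rfl⟩
  exact ⟨_, subset_closure ⟨s, hs, rfl⟩, rfl⟩

/-- Relative weak compactness can be checked after an isometric embedding, since by Hahn-Banach the
double limit property involves the same functionals on both sides. -/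
theorem IsRelWeaklyCompact.of_image [CompleteSpace E] {S : Set E} (T : E →ₗᵢ[ℝ] F)
    (hS : IsRelWeaklyCompact (T '' S)) : IsRelWeaklyCompact S := by
  refine HasDualBallDLP.isRelWeaklyCompact ?_ fun y hy x hx u v a b hu ha hv hb => ?_
  · exact (T.antilipschitz.isBounded_preimage hS.isBounded).subset (Set.subset_preimage_image _ _)
  -- functionals on `E` are restrictions of functionals on `F` of the same norm
  have hext : ∀ m, ∃ x' : StrongDual ℝ F, ‖x'‖ ≤ 1 ∧ ∀ e, x' (T e) = x m e := by
    intro m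
    obtain ⟨x', hx', hn⟩ := exists_extension_norm_eq (LinearMap.range T.toLinearMap)
      ((x m).comp T.equivRange.symm.toContinuousLinearEquiv.toContinuousLinearMap)
    refine ⟨x', ?_, fun e => ?_⟩
    · rw [hn]
      refine ContinuousLinearMap.opNorm_le_bound _ zero_le_one fun z => ?_
      refine ((x m).le_of_opNorm_le (hx m) _).trans (le_of_eq ?_)
      rw [one_mul, one_mul]
      exact T.equivRange.symm.norm_map z
    · have h := hx' (T.equivRange e)
      refine Eq.trans h (congrArg (x m) ?_)
      exact T.equivRange.symm_apply_apply e
  choose x' hx'1 hx'e using hext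
  refine hS.hasDualBallDLP (fun n => T (y n)) (fun n => ⟨_, hy n, rfl⟩) x' hx'1 u v a b ?_ ha ?_ hb
  · simpa only [hx'e] using hu
  · simpa only [hx'e] using hv

end WeakCompactness

/-! ### Krein's theorem -/

section Krein

/-- Bounded pointwise convergence in `C(K)` is preserved by positive functionals: these are measures
by the Riesz-Markov-Kakutani theorem, and dominated convergence applies. -/
theorem tendsto_of_positive_of_tendsto_pointwise {K : Type*} [TopologicalSpace K] [CompactSpace K]
    [T2Space K] (Λ : C(K, ℝ) →ₗ[ℝ] ℝ) (hΛ : ∀ f, 0 ≤ f → 0 ≤ Λ f) {f : ℕ → C(K, ℝ)}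
    {g : C(K, ℝ)} {C : ℝ} (hC : ∀ n, ‖f n‖ ≤ C)
    (h : ∀ k, Tendsto (fun n => f n k) atTop (𝓝 (g k))) :
    Tendsto (fun n => Λ (f n)) atTop (𝓝 (Λ g)) := by
  let _ : MeasurableSpace K := borel K
  have : BorelSpace K := ⟨rfl⟩
  let toC : CompactlySupportedContinuousMap K ℝ →ₗ[ℝ] C(K, ℝ) :=
    { toFun := fun f => f.toContinuousMap
      map_add' := fun _ _ => rfl
      map_smul' := fun _ _ => rfl }
  let Λ' : CompactlySupportedContinuousMap K ℝ →ₚ[ℝ] ℝ :=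
    PositiveLinearMap.mk₀ (Λ.comp toC) fun f hf => hΛ _ hf
  have hint : ∀ f : C(K, ℝ), ∫ k, f k ∂(RealRMK.rieszMeasure Λ') = Λ f := fun f =>
    RealRMK.integral_rieszMeasure Λ' (CompactlySupportedContinuousMap.continuousMapEquiv f)
  simp only [← hint]
  refine tendsto_integral_of_dominated_convergence (fun _ => C)
    (fun n => (f n).continuous.aestronglyMeasurable) (integrable_const C)
    (fun n => Eventually.of_forall fun k => ((f n).norm_coe_le_norm k).trans (hC n))
    (Eventually.of_forall h)

variable {E : Type*} [NormedAddCommGroup E] [NormedSpace ℝ E]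

/-- The restriction of a functional to a set with the weak topology. -/
def restrictWeak (K : Set (WeakSpace ℝ E)) (x : StrongDual ℝ E) : C(K, ℝ) where
  toFun w := x ((toWeakSpace ℝ E).symm w)
  continuous_toFun := (continuous_apply_toWeakSpace_symm x).comp continuous_subtype_val

theorem exists_subseq_tendsto_on_countable (x : ℕ → StrongDual ℝ E) (hx : ∀ m, ‖x m‖ ≤ 1)
    {S : Set E} (hS : S.Countable) :
    ∃ ψ : ℕ → ℕ, StrictMono ψ ∧ ∃ c : S → ℝ, ∀ s : S,
      Tendsto (fun k => x (ψ k) s) atTop (𝓝 (c s)) := by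
  have : Countable S := hS
  have hK : IsCompact (Set.univ.pi fun s : S => Metric.closedBall (0 : ℝ) ‖(s : E)‖) :=
    isCompact_univ_pi fun s => isCompact_closedBall _ _
  obtain ⟨c, -, ψ, hψ, hc⟩ := hK.tendsto_subseq (x := fun (m : ℕ) (s : S) => x m s)
    fun m s _ => by
    simpa using (x m).le_of_opNorm_le (hx m) s
  exact ⟨ψ, hψ, c, fun s => (tendsto_pi_nhds.1 hc) s⟩

/-- Points of the convex hull of `S` are barycentres of positive functionals of norm at most one on
`C(K)`, where `K` is a compact set containing `S`. -/
theorem exists_barycentre_functional {S : Set E} {K : Set (WeakSpace ℝ E)} [CompactSpace K]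
    (hSK : toWeakSpace ℝ E '' S ⊆ K) {z : E} (hz : z ∈ convexHull ℝ S) :
    ∃ Λ : StrongDual ℝ C(K, ℝ), ‖Λ‖ ≤ 1 ∧ (∀ f, 0 ≤ f → 0 ≤ Λ f) ∧
      ∀ x, Λ (restrictWeak K x) = x z := by
  let T : Set E := {z | ∃ Λ : StrongDual ℝ C(K, ℝ), ‖Λ‖ ≤ 1 ∧ (∀ f, 0 ≤ f → 0 ≤ Λ f) ∧
      ∀ x, Λ (restrictWeak K x) = x z}
  have hST : S ⊆ T := fun s hs => by
    refine ⟨ContinuousMap.evalCLM ℝ ⟨toWeakSpace ℝ E s, hSK ⟨s, hs, rfl⟩⟩, ?_, fun f hf => hf _,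
      fun x => rfl⟩
    exact ContinuousLinearMap.opNorm_le_bound _ zero_le_one fun f => by
      rw [one_mul]; exact f.norm_coe_le_norm _
  have hT : Convex ℝ T := by
    rintro z ⟨Λ, h1, h2, h3⟩ z' ⟨Λ', h1', h2', h3'⟩ a b ha hb hab
    refine ⟨a • Λ + b • Λ', ?_, fun f hf => ?_, fun x => ?_⟩
    · refine ContinuousLinearMap.opNorm_le_bound _ zero_le_one fun f => ?_
      exact convex_closedBall (0 : ℝ) (1 * ‖f‖)
        (mem_closedBall_zero_iff.2 (Λ.le_of_opNorm_le h1 f))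
        (mem_closedBall_zero_iff.2 (Λ'.le_of_opNorm_le h1' f)) ha hb hab |>
        mem_closedBall_zero_iff.1
    · exact add_nonneg (mul_nonneg ha (h2 f hf)) (mul_nonneg hb (h2' f hf))
    · simp [h3, h3']
  exact convexHull_min hST hT hz

/-- **Krein's theorem**: the convex hull of a relatively weakly compact set in a Banach space is
relatively weakly compact. The double limit property of the hull is checked by regarding its points
as functionals on `C(K)`, for the weak closure `K` of a countable part of the set: a subsequence of
the `x m` converges pointwise on `K` to a continuous function, and a cluster point of the functionals
respects this limit by dominated convergence. -/
theorem IsRelWeaklyCompact.convexHull [CompleteSpace E] {S : Set E} (hS : IsRelWeaklyCompact S) :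
    IsRelWeaklyCompact (convexHull ℝ S) := by
  refine HasDualBallDLP.isRelWeaklyCompact (isBounded_convexHull.2 hS.isBounded)
    fun y hy x hx u v a b hu ha hv hb => ?_
  -- all `y n` are in the convex hull of one countable set `S₀`
  have hfin : ∀ n, ∃ t : Finset E, (t : Set E) ⊆ S ∧ y n ∈ _root_.convexHull ℝ (t : Set E) := by
    intro n
    have := hy n
    rw [convexHull_eq_union_convexHull_finite_subsets] at this
    simpa using this
  choose t htS hyt using hfin
  let S₀ : Set E := ⋃ n, (t n : Set E)
  have hS₀S : S₀ ⊆ S := Set.iUnion_subset htS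
  have hS₀c : S₀.Countable := Set.countable_iUnion fun n => (t n).countable_toSet
  have hyS₀ : ∀ n, y n ∈ _root_.convexHull ℝ S₀ := fun n =>
    convexHull_mono (Set.subset_iUnion (fun n => (t n : Set E)) n) (hyt n)
  let K : Set (WeakSpace ℝ E) := closure (toWeakSpace ℝ E '' S₀)
  have hK : IsCompact K := hS.mono hS₀S
  have : CompactSpace K := isCompact_iff_compactSpace.1 hK
  obtain ⟨ψ, hψ, c, hc⟩ := exists_subseq_tendsto_on_countable x hx hS₀c
  -- every ultrafilter limit of the subsequence restricts to the same function on `K`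
  have hlim : ∀ 𝒰 : Ultrafilter ℕ, ∃ ξ : StrongDual ℝ E,
      ∀ e, Tendsto (fun k => x (ψ k) e) 𝒰 (𝓝 (ξ e)) := by
    intro 𝒰
    obtain ⟨ξ, -, hξ⟩ := (WeakDual.isCompact_closedBall (0 : StrongDual ℝ E) 1).ultrafilter_le_nhds
      (𝒰.map fun k => StrongDual.toWeakDual (x (ψ k)))
      (le_principal_iff.2 (Ultrafilter.mem_coe.2 <| Ultrafilter.mem_map.2 <| univ_mem' fun k =>
        mem_closedBall_zero_iff.2 (hx (ψ k))))
    exact ⟨WeakDual.toStrongDual ξ, fun e =>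
      ((WeakDual.eval_continuous e).tendsto ξ).comp (show Tendsto _ _ _ from hξ)⟩
  obtain ⟨ξ, hξ⟩ := hlim (hyperfilter ℕ)
  have hξK : ∀ w : K, Tendsto (fun k => restrictWeak K (x (ψ k)) w) atTop
      (𝓝 (restrictWeak K ξ w)) := by
    intro w
    rw [tendsto_iff_ultrafilter]
    intro 𝒱 h𝒱
    obtain ⟨ξ', hξ'⟩ := hlim 𝒱
    have hcl : IsClosed {w : WeakSpace ℝ E | ξ' ((toWeakSpace ℝ E).symm w) =
        ξ ((toWeakSpace ℝ E).symm w)} :=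
      isClosed_eq (continuous_apply_toWeakSpace_symm ξ') (continuous_apply_toWeakSpace_symm ξ)
    have hsub : K ⊆ {w : WeakSpace ℝ E | ξ' ((toWeakSpace ℝ E).symm w) =
        ξ ((toWeakSpace ℝ E).symm w)} := by
      refine closure_minimal ?_ hcl
      rintro _ ⟨s, hs, rfl⟩
      exact (tendsto_nhds_unique (hξ' s) ((hc ⟨s, hs⟩).mono_left h𝒱)).trans
        (tendsto_nhds_unique (hξ s)
          ((hc ⟨s, hs⟩).mono_left Nat.hyperfilter_le_atTop)).symm
    have := hξ' ((toWeakSpace ℝ E).symm w)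
    rw [show ξ' ((toWeakSpace ℝ E).symm w) = restrictWeak K ξ w from hsub w.2] at this
    exact this
  -- a cluster point `Λ` of functionals on `C(K)` with barycentres `y n`
  choose Λ hΛ1 hΛ0 hΛe using fun n => exists_barycentre_functional subset_closure (hyS₀ n)
  let 𝒰 : Ultrafilter ℕ := hyperfilter ℕ
  have h𝒰 : (𝒰 : Filter ℕ) ≤ atTop := Nat.hyperfilter_le_atTop
  obtain ⟨Θ, -, hΘ⟩ := (WeakDual.isCompact_closedBall
      (0 : StrongDual ℝ C(K, ℝ)) 1).ultrafilter_le_nhds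
    (𝒰.map fun n => StrongDual.toWeakDual (Λ n))
    (le_principal_iff.2 (Ultrafilter.mem_coe.2 <| Ultrafilter.mem_map.2 <| univ_mem' fun n =>
      mem_closedBall_zero_iff.2 (hΛ1 n)))
  have hΘ' : ∀ f, Tendsto (fun n => Λ n f) 𝒰 (𝓝 (Θ f)) := fun f =>
    ((WeakDual.eval_continuous f).tendsto Θ).comp (show Tendsto _ _ _ from hΘ)
  have hpos : ∀ f : C(K, ℝ), 0 ≤ f → 0 ≤ Θ f := fun f hf =>
    ge_of_tendsto' (hΘ' f) fun n => hΛ0 n f hf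
  obtain ⟨C', hC'⟩ : ∃ C', ∀ m, ‖restrictWeak K (x m)‖ ≤ C' := by
    have hKb : Bornology.IsBounded ((toWeakSpace ℝ E).symm '' K) := by
      have : IsRelWeaklyCompact ((toWeakSpace ℝ E).symm '' K) := by
        have h : toWeakSpace ℝ E '' ((toWeakSpace ℝ E).symm '' K) = K := by
          rw [Set.image_image]; simp
        rw [IsRelWeaklyCompact, h, hK.isClosed.closure_eq]
        exact hK
      exact this.isBounded
    obtain ⟨C', hC'⟩ := hKb.exists_norm_le
    refine ⟨max C' 0, fun m => (ContinuousMap.norm_le _ (le_max_right _ _)).2 fun w => ?_⟩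
    refine ((x m).le_of_opNorm_le (hx m) _).trans ?_
    rw [one_mul]
    exact (hC' _ ⟨w, w.2, rfl⟩).trans (le_max_left _ _)
  have hmain := tendsto_of_positive_of_tendsto_pointwise
    (WeakDual.toStrongDual Θ).toLinearMap hpos (fun k => hC' (ψ k)) hξK
  have h1 : ∀ m, Θ (restrictWeak K (x m)) = v m := fun m =>
    tendsto_nhds_unique (hΘ' _) (((hv m).mono_left h𝒰).congr fun n => (hΛe n _).symm)
  have h2 : ∀ n, ξ (y n) = u n := fun n =>
    tendsto_nhds_unique (hξ (y n)) (((hu n).comp hψ.tendsto_atTop).mono_left h𝒰)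
  have h3 : Θ (restrictWeak K ξ) = a :=
    tendsto_nhds_unique (hΘ' _) ((ha.mono_left h𝒰).congr fun n => by rw [hΛe, h2])
  have h4 : Tendsto (fun k => v (ψ k)) atTop (𝓝 (Θ (restrictWeak K ξ))) :=
    hmain.congr fun k => h1 (ψ k)
  rw [← h3]
  exact tendsto_nhds_unique h4 (hb.comp hψ.tendsto_atTop)

end Krein

/-! ### Weak-star limits in relatively weakly compact sets -/

/-- A weak-star limit of elements of a relatively weakly compact subset of a dual space lies in the
weak closure of that set. -/
theorem IsRelWeaklyCompact.mem_closure_of_tendsto {A : Type*} [NormedAddCommGroup A]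
    [NormedSpace ℝ A] {S : Set (StrongDual ℝ A)} (hS : IsRelWeaklyCompact S) {ι : Type*}
    {l : Filter ι} [l.NeBot] {ψ : ι → StrongDual ℝ A} (hψ : ∀ᶠ i in l, ψ i ∈ S)
    {ξ : StrongDual ℝ A} (h : ∀ b, Tendsto (fun i => ψ i b) l (𝓝 (ξ b))) :
    toWeakSpace ℝ (StrongDual ℝ A) ξ ∈ closure (toWeakSpace ℝ (StrongDual ℝ A) '' S) := by
  let 𝒰 : Ultrafilter ι := Ultrafilter.of l
  have h𝒰 : (𝒰 : Filter ι) ≤ l := Ultrafilter.of_le l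
  obtain ⟨w, hw, hlim⟩ := hS.ultrafilter_le_nhds
    (𝒰.map fun i => toWeakSpace ℝ (StrongDual ℝ A) (ψ i))
    (le_principal_iff.2 (Ultrafilter.mem_coe.2 <| Ultrafilter.mem_map.2 <|
      mem_of_superset (h𝒰 hψ) fun i hi => subset_closure ⟨ψ i, hi, rfl⟩))
  have : ξ = (toWeakSpace ℝ (StrongDual ℝ A)).symm w := by
    ext b
    refine tendsto_nhds_unique ((h b).mono_left h𝒰) ?_
    exact ((continuous_apply_toWeakSpace_symm
      (NormedSpace.inclusionInDoubleDual ℝ A b)).tendsto w).comp (show Tendsto _ _ _ from hlim)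
  rwa [this, LinearEquiv.apply_symm_apply]

/-! ### Probability densities and orbits in `L^∞(G)` -/

section Group

variable {G : Type*} [Group G] [TopologicalSpace G] [IsTopologicalGroup G] [LocallyCompactSpace G]
  [T2Space G] [MeasurableSpace G] [BorelSpace G] (μ : Measure G) [μ.IsHaarMeasure] [μ.Regular]

theorem convolutionL1_apply (a b : Lp ℝ 1 μ) :
    convolutionL1 μ a b = ∫ h, a h • translateL1 μ h b ∂μ := rfl

/-- The class in `L¹(G)` of a continuous function with compact support. -/
def ccToL1 (f : C_c(G, ℝ)) : Lp ℝ 1 μ :=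
  (f.continuous.memLp_of_hasCompactSupport f.hasCompactSupport).toLp f

theorem coeFn_ccToL1 (f : C_c(G, ℝ)) : ccToL1 μ f =ᵐ[μ] f := MemLp.coeFn_toLp _

theorem integral_ccToL1_smul {X : Type*} [NormedAddCommGroup X] [NormedSpace ℝ X] (f : C_c(G, ℝ))
    (F : G → X) : ∫ h, ccToL1 μ f h • F h ∂μ = ∫ h, f h • F h ∂μ :=
  integral_congr_ae ((coeFn_ccToL1 μ f).mono fun h hh => congrArg (· • F h) hh)

theorem toDual_ccToL1 (k : G →ᵇ ℝ) (f : C_c(G, ℝ)) :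
    toDual μ k (ccToL1 μ f) = ∫ g, f g * k g ∂μ :=
  integral_ccToL1_smul μ f k

theorem norm_ccToL1_sub (f g : C_c(G, ℝ)) : ‖ccToL1 μ f - ccToL1 μ g‖ = ∫ x, |f x - g x| ∂μ := by
  rw [L1.norm_eq_integral_norm]
  refine integral_congr_ae ?_
  filter_upwards [coeFn_ccToL1 μ f, coeFn_ccToL1 μ g, Lp.coeFn_sub (ccToL1 μ f) (ccToL1 μ g)]
    with x h1 h2 h3
  rw [h3, Pi.sub_apply, h1, h2, Real.norm_eq_abs]

theorem norm_ccToL1 (f : C_c(G, ℝ)) : ‖ccToL1 μ f‖ = ∫ x, |f x| ∂μ := by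
  rw [L1.norm_eq_integral_norm]
  exact integral_congr_ae ((coeFn_ccToL1 μ f).mono fun x h => congrArg norm h)

/-- By Urysohn's lemma, indicators of sets of finite measure are `L¹`-limits of functions in
`C_c(G)`. Mathlib's density theorem `MemLp.exists_hasCompactSupport_eLpNorm_sub_le` assumes a normal
space; here Urysohn's lemma is applied to a compact set inside an open one. -/
theorem exists_cc_eLpNorm_sub_indicator_le (c : ℝ) {s : Set G} (hs : MeasurableSet s)
    (hμs : μ s < ∞) {δ : ℝ≥0∞} (hδ : δ ≠ 0) :
    ∃ g : G → ℝ, eLpNorm (g - s.indicator fun _ => c) 1 μ ≤ δ ∧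
      (Continuous g ∧ HasCompactSupport g) := by
  obtain ⟨η, hη, hηle⟩ := exists_eLpNorm_indicator_le (μ := μ) ENNReal.one_ne_top c hδ
  have hη2 : ((η : ℝ≥0∞) / 2) ≠ 0 := (ENNReal.half_pos (ENNReal.coe_pos.2 hη).ne').ne'
  obtain ⟨K, hKs, hK, -, hKμ⟩ := hs.exists_isCompact_isClosed_sdiff_lt hμs.ne hη2
  obtain ⟨U, hsU, hU, -, hUμ⟩ := hs.exists_isOpen_sdiff_lt hμs.ne hη2
  obtain ⟨k, hk1, hk0, hkc, hk⟩ := exists_continuous_one_zero_of_isCompact hK hU.isClosed_compl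
    (Set.disjoint_compl_right_iff_subset.2 (hKs.trans hsU))
  refine ⟨fun x => k x * c, ?_, k.continuous.mul continuous_const, hkc.mul_right⟩
  refine (eLpNorm_mono fun x => ?_).trans (hηle (U \ K) ?_)
  · by_cases hxK : x ∈ K
    · simp [hk1 hxK, hKs hxK]
    by_cases hxU : x ∈ U
    · rw [Set.indicator_of_mem (show x ∈ U \ K from ⟨hxU, hxK⟩), Pi.sub_apply]
      have := hk x
      by_cases hxs : x ∈ s
      · rw [Set.indicator_of_mem hxs, ← sub_one_mul, norm_mul]
        refine mul_le_of_le_one_left (norm_nonneg _) ?_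
        rw [Real.norm_eq_abs, abs_le]
        constructor <;> linarith [this.1, this.2]
      · rw [Set.indicator_of_notMem hxs, sub_zero, norm_mul]
        refine mul_le_of_le_one_left (norm_nonneg _) ?_
        rw [Real.norm_of_nonneg this.1]
        exact this.2
    · have hxs : x ∉ s := fun h => hxU (hsU h)
      simp [hk0 hxU, hxs]
  · have hsub : U \ K ⊆ (U \ s) ∪ (s \ K) := fun x hx => by
      by_cases hxs : x ∈ s
      · exact Or.inr ⟨hxs, hx.2⟩
      · exact Or.inl ⟨hx.1, hxs⟩
    refine (measure_mono hsub).trans ((measure_union_le _ _).trans ?_)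
    exact (add_le_add hUμ.le hKμ.le).trans (ENNReal.add_halves _).le

theorem denseRange_ccToL1 : DenseRange (ccToL1 μ : C_c(G, ℝ) → Lp ℝ 1 μ) := by
  intro a
  rw [EMetric.mem_closure_iff]
  intro ε hε
  obtain ⟨ε', hε', hlt⟩ := exists_between hε
  obtain ⟨g, hle, hg, hgc⟩ := (Lp.memLp a).induction_dense ENNReal.one_ne_top
    (fun g => Continuous g ∧ HasCompactSupport g)
    (fun c s hs hμs {δ} hδ => exists_cc_eLpNorm_sub_indicator_le μ c hs hμs hδ)
    (fun f g hf hg => ⟨hf.1.add hg.1, hf.2.add hg.2⟩)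
    (fun f hf => (hf.1.memLp_of_hasCompactSupport (p := 1) hf.2).aestronglyMeasurable) hε'.ne'
  refine ⟨ccToL1 μ ⟨⟨g, hg⟩, hgc⟩, ⟨_, rfl⟩, lt_of_le_of_lt ?_ hlt⟩
  rw [Lp.edist_def]
  refine le_of_eq_of_le (eLpNorm_congr_ae ?_) hle
  filter_upwards [coeFn_ccToL1 μ ⟨⟨g, hg⟩, hgc⟩] with x h
  rw [Pi.sub_apply, Pi.sub_apply, h]
  rfl

theorem integrable_cc_smul {X : Type*} [NormedAddCommGroup X] [NormedSpace ℝ X] (f : C_c(G, ℝ))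
    {F : G → X} (hF : Continuous F) : Integrable (fun h => f h • F h) μ :=
  (f.continuous.smul hF).integrable_of_hasCompactSupport f.hasCompactSupport.smul_right

/-- The probability densities in `C_c(G)` with support in `U`, as elements of `L¹(G)`. -/
def densities (U : Set G) : Set (Lp ℝ 1 μ) :=
  ccToL1 μ '' {k : C_c(G, ℝ) | (∀ x, 0 ≤ k x) ∧ ∫ x, k x ∂μ = 1 ∧ ∀ x, x ∉ U → k x = 0}

theorem monotone_densities : Monotone (densities μ) := fun _ _ h =>
  Set.image_mono fun _ hk => ⟨hk.1, hk.2.1, fun x hx => hk.2.2 x fun hx' => hx (h hx')⟩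

theorem norm_le_one_of_mem_densities {U : Set G} {e : Lp ℝ 1 μ} (he : e ∈ densities μ U) :
    ‖e‖ ≤ 1 := by
  obtain ⟨k, hk, rfl⟩ := he
  rw [norm_ccToL1, ← hk.2.1]
  exact le_of_eq (integral_congr_ae (Eventually.of_forall fun x => abs_of_nonneg (hk.1 x)))

theorem densities_nonempty {x : G} {U : Set G} (hU : U ∈ 𝓝 x) : (densities μ U).Nonempty := by
  obtain ⟨V, hVU, hV, hxV⟩ := mem_nhds_iff.1 hU
  obtain ⟨f, hf1, hf0, hfc, hf⟩ := exists_continuous_one_zero_of_isCompact (isCompact_singleton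
    (x := x)) hV.isClosed_compl (by simpa using hxV)
  have hpos : 0 < ∫ y, f y ∂μ :=
    f.continuous.integral_pos_of_hasCompactSupport_nonneg_nonzero hfc (fun y => (hf y).1)
      (x := x) (by rw [hf1 rfl]; simp)
  refine ⟨_, (∫ y, f y ∂μ)⁻¹ • (⟨f, hfc⟩ : C_c(G, ℝ)), ⟨fun y => ?_, ?_, fun y hy => ?_⟩, rfl⟩
  · exact mul_nonneg (inv_nonneg.2 hpos.le) (hf y).1
  · change ∫ y, (∫ y, f y ∂μ)⁻¹ * f y ∂μ = 1
    rw [integral_const_mul, inv_mul_cancel₀ hpos.ne']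
  · change (∫ y, f y ∂μ)⁻¹ * f y = 0
    rw [hf0 (fun h => hy (hVU h)), Pi.zero_apply, mul_zero]

/-- The filter on `L¹(G)` of probability densities concentrating at `x`. -/
def diracFilter (x : G) : Filter (Lp ℝ 1 μ) := (𝓝 x).lift' (densities μ)

instance diracFilter_neBot (x : G) : (diracFilter μ x).NeBot :=
  (lift'_neBot_iff (monotone_densities μ)).2 fun _ hU => densities_nonempty μ hU

theorem densities_univ_mem_diracFilter (x : G) : densities μ Set.univ ∈ diracFilter μ x :=
  mem_lift' univ_mem

theorem tendsto_integral_smul_diracFilter {X : Type*} [NormedAddCommGroup X] [NormedSpace ℝ X]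
    [CompleteSpace X] {F : G → X} (hF : Continuous F) (x : G) :
    Tendsto (fun e : Lp ℝ 1 μ => ∫ h, e h • F h ∂μ) (diracFilter μ x) (𝓝 (F x)) := by
  rw [Metric.tendsto_nhds]
  intro ε hε
  have hU : {y | ‖F y - F x‖ < ε / 2} ∈ 𝓝 x := by
    have := hF.continuousAt (Metric.ball_mem_nhds (F x) (half_pos hε))
    simpa [Metric.ball, dist_eq_norm] using this
  filter_upwards [mem_lift' hU]
  rintro _ ⟨k, ⟨hk0, hk1, hks⟩, rfl⟩
  have hki : Integrable k μ := k.continuous.integrable_of_hasCompactSupport k.hasCompactSupport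
  have h1 : ∫ h, k h • F x ∂μ = F x := by rw [integral_smul_const, hk1, one_smul]
  rw [integral_ccToL1_smul, dist_eq_norm, ← h1, ← integral_sub (integrable_cc_smul μ k hF)
    (integrable_cc_smul μ k continuous_const)]
  refine lt_of_le_of_lt (norm_integral_le_of_norm_le (hki.mul_const (ε / 2))
    (Eventually.of_forall fun h => ?_)) ?_
  · rw [← smul_sub, norm_smul, Real.norm_of_nonneg (hk0 h)]
    by_cases hh : ‖F h - F x‖ < ε / 2
    · exact mul_le_mul_of_nonneg_left hh.le (hk0 h)
    · rw [hks h hh, zero_mul, zero_mul]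
  · rw [integral_mul_const, hk1, one_mul]
    exact half_lt_self hε

theorem tendsto_convolutionL1_diracFilter (x : G) (b : Lp ℝ 1 μ) :
    Tendsto (fun e => convolutionL1 μ e b) (diracFilter μ x) (𝓝 (translateL1 μ x b)) :=
  tendsto_integral_smul_diracFilter μ (continuous_translateL1 μ b) x

theorem tendsto_toDual_diracFilter (x : G) (f : G →ᵇ ℝ) :
    Tendsto (toDual μ f) (diracFilter μ x) (𝓝 (f x)) :=
  tendsto_integral_smul_diracFilter μ f.continuous x

theorem norm_toDual_bcf (f : G →ᵇ ℝ) : ‖toDual μ f‖ = ‖f‖ := by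
  refine le_antisymm (LinearMap.mkContinuous_norm_le _ (norm_nonneg _) _) ?_
  refine (BoundedContinuousFunction.norm_le (norm_nonneg _)).2 fun x => ?_
  refine le_of_tendsto (tendsto_toDual_diracFilter μ x f).norm ?_
  filter_upwards [densities_univ_mem_diracFilter μ x] with e he
  exact ((toDual μ f).le_opNorm e).trans
    (mul_le_of_le_one_right (norm_nonneg _) (norm_le_one_of_mem_densities μ he))

theorem integrable_mul_bcf (a : Lp ℝ 1 μ) (f : G →ᵇ ℝ) : Integrable (fun g => a g * f g) μ :=
  (L1.integrable_coeFn a).mul_bdd (c := ‖f‖) f.continuous.measurable.aestronglyMeasurable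
    (Eventually.of_forall f.norm_coe_le_norm)

/-- The isometric embedding of `C_b(G)` into `L^∞(G)`. -/
def toDualLI : (G →ᵇ ℝ) →ₗᵢ[ℝ] StrongDual ℝ (Lp ℝ 1 μ) where
  toFun := toDual μ
  map_add' f f' := by
    ext a
    change ∫ g, a g * (f g + f' g) ∂μ = ∫ g, a g * f g ∂μ + ∫ g, a g * f' g ∂μ
    rw [← integral_add (integrable_mul_bcf μ a f) (integrable_mul_bcf μ a f')]
    simp only [mul_add]
  map_smul' c f := by
    ext a
    change ∫ g, a g * (c * f g) ∂μ = c * ∫ g, a g * f g ∂μ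
    rw [← integral_const_mul]
    simp only [mul_left_comm]
  norm_map' := norm_toDual_bcf μ

theorem toDual_translateBCF (f : G →ᵇ ℝ) (h : G) :
    toDual μ (translateBCF f h) =
      (toDual μ f).comp (translateL1 μ h).toContinuousLinearMap := by
  ext b
  change ∫ g, b g * f (h * g) ∂μ = ∫ g, translateL1 μ h b g * f g ∂μ
  rw [← integral_mul_left_eq_self (fun g => translateL1 μ h b g * f g) h]
  refine integral_congr_ae ?_
  have := (measurePreserving_mul_left μ h).quasiMeasurePreserving.ae (coeFn_translateL1 μ h b)
  filter_upwards [this] with g hg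
  rw [hg, inv_mul_cancel_left]

theorem dualAct_convolutionL1_apply (φ : StrongDual ℝ (Lp ℝ 1 μ)) (a b : Lp ℝ 1 μ) :
    dualAct (convolutionL1 μ) φ a b = ∫ h, a h * φ (translateL1 μ h b) ∂μ := by
  change φ (∫ h, a h • translateL1 μ h b ∂μ) = _
  rw [← φ.integral_comp_comm (integrable_smul_translateL1 μ a b)]
  simp

/-- For weakly almost periodic `φ`, the translates `φ · x` are weak limits of elements `φ · e` with `e`
a probability density near `x`. -/
theorem comp_translateL1_mem_closure {φ : StrongDual ℝ (Lp ℝ 1 μ)}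
    (hφ : φ ∈ wapFunctionals (convolutionL1 μ)) (x : G) :
    toWeakSpace ℝ _ (φ.comp (translateL1 μ x).toContinuousLinearMap) ∈
      closure (toWeakSpace ℝ _ '' (dualAct (convolutionL1 μ) φ '' densities μ Set.univ)) := by
  have hsub : dualAct (convolutionL1 μ) φ '' densities μ Set.univ ⊆
      ballOrbit (convolutionL1 μ) φ := Set.image_mono fun e he =>
    mem_closedBall_zero_iff.2 (norm_le_one_of_mem_densities μ he)
  refine (IsRelWeaklyCompact.mono hφ hsub).mem_closure_of_tendsto (l := diracFilter μ x)
    (ψ := dualAct (convolutionL1 μ) φ) ?_ fun b => ?_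
  · filter_upwards [densities_univ_mem_diracFilter μ x] with e he
    exact ⟨e, he, rfl⟩
  · exact (φ.continuous.tendsto _).comp (tendsto_convolutionL1_diracFilter μ x b)

theorem translateL1_one (b : Lp ℝ 1 μ) : translateL1 μ 1 b = b := by
  refine Lp.ext ?_
  filter_upwards [coeFn_translateL1 μ 1 b] with x hx
  rw [hx, inv_one, one_mul]

/-- A weakly almost periodic functional `φ` is in every norm closed convex set that contains all
`φ · e` with `e` a continuous probability density of compact support. -/
theorem mem_of_mem_wapFunctionals {φ : StrongDual ℝ (Lp ℝ 1 μ)}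
    (hφ : φ ∈ wapFunctionals (convolutionL1 μ)) {V : Set (StrongDual ℝ (Lp ℝ 1 μ))}
    (hV : Convex ℝ V) (hVc : IsClosed V)
    (h : ∀ f : C_c(G, ℝ), dualAct (convolutionL1 μ) φ (ccToL1 μ f) ∈ V) : φ ∈ V := by
  have h1 := comp_translateL1_mem_closure μ hφ 1
  have h2 : φ.comp (translateL1 μ 1).toContinuousLinearMap = φ := by
    ext b
    exact congrArg φ (translateL1_one μ b)
  have h3 : dualAct (convolutionL1 μ) φ '' densities μ Set.univ ⊆ V := by
    rintro _ ⟨_, ⟨f, -, rfl⟩, rfl⟩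
    exact h f
  rw [h2] at h1
  have h4 := closure_mono (Set.image_mono h3) h1
  rw [← hV.toWeakSpace_closure ℝ, hVc.closure_eq] at h4
  obtain ⟨ψ, hψ, he⟩ := h4
  rwa [← (toWeakSpace ℝ _).injective he]

/-- Weakly almost periodic functionals are right uniformly continuous, because `φ` is a weak limit of
functionals `φ · e`, and the weak and norm closures of a subspace agree. -/
theorem wapFunctionals_subset_rucFunctionals :
    wapFunctionals (convolutionL1 μ) ⊆ rucFunctionals (convolutionL1 μ) := fun φ hφ =>
  mem_of_mem_wapFunctionals μ hφ (rucFunctionals (convolutionL1 μ)).convex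
    (Submodule.isClosed_topologicalClosure _) fun f =>
    Submodule.le_topologicalClosure _ (Submodule.subset_span ⟨(φ, ccToL1 μ f), rfl⟩)

/-- If the orbit `f · G` is relatively weakly compact in `L^∞(G)`, then `f` is weakly almost periodic as
a functional. By Krein's theorem the closed convex hull of `± f · G` is weakly compact, hence
weak-star closed, and it contains `f · a` for `‖a‖ ≤ 1`: otherwise some `b ∈ L¹(G)` would separate
them, whereas `(f · a)(b) = ∫ a(h) (f · h)(b) dh`. -/
theorem toDual_mem_wapFunctionals {f : G →ᵇ ℝ}
    (hf : IsRelWeaklyCompact (toDual μ '' groupOrbit f)) :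
    toDual μ f ∈ wapFunctionals (convolutionL1 μ) := by
  let D := StrongDual ℝ (Lp ℝ 1 μ)
  let S : Set D := toDual μ '' groupOrbit f
  have hneg : IsRelWeaklyCompact ((-ContinuousLinearMap.id ℝ D) '' S) := hf.image _
  have hT : IsRelWeaklyCompact (S ∪ (-ContinuousLinearMap.id ℝ D) '' S) := by
    rw [IsRelWeaklyCompact, Set.image_union, closure_union]
    exact IsCompact.union hf hneg
  set T : Set D := S ∪ (-ContinuousLinearMap.id ℝ D) '' S
  have hK : IsRelWeaklyCompact (convexHull ℝ T) := hT.convexHull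
  -- the norm closed convex hull `C` is weak-star closed, being weakly compact
  let C : Set D := closure (convexHull ℝ T)
  have hC : IsCompact (toWeakSpace ℝ D '' C) := by
    rw [(convex_convexHull ℝ T).toWeakSpace_closure ℝ]
    exact hK
  have hcont : Continuous fun w : WeakSpace ℝ D =>
      StrongDual.toWeakDual ((toWeakSpace ℝ D).symm w) :=
    WeakBilin.continuous_of_continuous_eval _ fun b =>
      continuous_apply_toWeakSpace_symm (NormedSpace.inclusionInDoubleDual ℝ (Lp ℝ 1 μ) b)
  have hC' : IsClosed (StrongDual.toWeakDual '' C) := by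
    have := (IsCompact.image hC hcont).isClosed
    simpa [Set.image_image] using this
  have hCconv : Convex ℝ (StrongDual.toWeakDual '' C) :=
    (convex_convexHull ℝ T).closure.linear_image
      (StrongDual.toWeakDual : D ≃ₗ[ℝ] WeakDual ℝ (Lp ℝ 1 μ)).toLinearMap
  suffices hsub : ballOrbit (convolutionL1 μ) (toDual μ f) ⊆ C by
    refine hC.of_isClosed_subset isClosed_closure ?_
    exact closure_minimal (Set.image_mono hsub) hC.isClosed
  rintro _ ⟨a, ha, rfl⟩
  by_contra hmem
  have hmem' : StrongDual.toWeakDual (dualAct (convolutionL1 μ) (toDual μ f) a) ∉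
      StrongDual.toWeakDual '' C := by
    rintro ⟨ψ, hψ, he⟩
    exact hmem (StrongDual.toWeakDual.injective he ▸ hψ)
  have : LocallyConvexSpace ℝ (WeakDual ℝ (Lp ℝ 1 μ)) :=
    inferInstanceAs (LocallyConvexSpace ℝ (WeakBilin (topDualPairing ℝ (Lp ℝ 1 μ))))
  obtain ⟨Φ, u, hΦC, hΦu⟩ := geometric_hahn_banach_closed_point hCconv hC' hmem'
  obtain ⟨b, rfl⟩ := LinearMap.dualEmbedding_surjective (topDualPairing ℝ (Lp ℝ 1 μ)) Φ
  have hTC : T ⊆ C := (subset_convexHull ℝ T).trans subset_closure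
  have hb : ∀ h : G, |toDual μ f (translateL1 μ h b)| ≤ u := by
    intro h
    have hS : toDual μ (translateBCF f h) ∈ S := ⟨_, ⟨h, rfl⟩, rfl⟩
    have h1 : toDual μ (translateBCF f h) b < u :=
      hΦC _ ⟨_, hTC (Or.inl hS), rfl⟩
    have h2 : -toDual μ (translateBCF f h) b < u :=
      hΦC _ ⟨_, hTC (Or.inr ⟨_, hS, rfl⟩), rfl⟩
    rw [toDual_translateBCF] at h1 h2
    exact abs_le.2 ⟨by linarith [show -toDual μ f (translateL1 μ h b) < u from h2], h1.le⟩
  have hu : 0 ≤ u := (abs_nonneg _).trans (hb 1)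
  have h1 : u < dualAct (convolutionL1 μ) (toDual μ f) a b := hΦu
  rw [dualAct_convolutionL1_apply] at h1
  have h2 : ‖∫ h, a h * toDual μ f (translateL1 μ h b) ∂μ‖ ≤ ∫ h, ‖a h‖ * u ∂μ :=
    norm_integral_le_of_norm_le ((L1.integrable_coeFn a).norm.mul_const u)
      (Eventually.of_forall fun h => by
        rw [norm_mul]; exact mul_le_mul_of_nonneg_left (hb h) (norm_nonneg _))
  rw [integral_mul_const, ← L1.norm_eq_integral_norm] at h2
  have h3 : ‖a‖ * u ≤ u := mul_le_of_le_one_left hu (mem_closedBall_zero_iff.1 ha)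
  linarith [Real.le_norm_self (∫ h, a h * toDual μ f (translateL1 μ h b) ∂μ)]

end Group

/-! ### Right translation of `C_c(G)` in `L¹(G)` and uniform continuity -/

section Group

variable {G : Type*} [Group G] [TopologicalSpace G] [IsTopologicalGroup G] [LocallyCompactSpace G]
  [T2Space G] [MeasurableSpace G] [BorelSpace G] (μ : Measure G) [μ.IsHaarMeasure] [μ.Regular]

/-- The modular function of `G`, with values in `ℝ`. -/
def modularReal (x : G) : ℝ := Measure.modularCharacterFun x

theorem modularReal_pos (x : G) : 0 < modularReal x := Measure.modularCharacterFun_pos x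

theorem modularReal_one : modularReal (1 : G) = 1 := by
  simp [modularReal, Measure.modularCharacterFun_map_one]

theorem modularReal_mul (x y : G) : modularReal (x * y) = modularReal x * modularReal y := by
  simp [modularReal, Measure.modularCharacterFun_map_mul]

/-- Right translation by `x` multiplies integrals by the modular function. -/
theorem integral_mul_right_eq {f : G → ℝ} (hf : Continuous f) (hc : HasCompactSupport f) (x : G) :
    ∫ g, f (g * x) ∂μ = modularReal x * ∫ g, f g ∂μ := by
  have h := Measure.integral_isMulLeftInvariant_eq_smul_of_hasCompactSupport
    (Measure.map (· * x) μ) μ hf hc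
  rw [integral_map (measurable_mul_const x).aemeasurable hf.aestronglyMeasurable,
    integral_smul_nnreal_measure, ← Measure.modularCharacterFun_eq_haarScalarFactor] at h
  exact h

theorem continuous_integral_mul_right {f : G → ℝ} (hf : Continuous f) (hc : HasCompactSupport f) :
    Continuous fun x => ∫ g, f (g * x) ∂μ := by
  rw [continuous_iff_continuousAt]
  intro x₀
  obtain ⟨V, hV, hVx⟩ := exists_compact_mem_nhds x₀
  have hk : IsCompact ((fun p : G × G => p.1 * p.2⁻¹) '' (tsupport f ×ˢ V)) :=
    (IsCompact.prod hc hV).image (by fun_prop)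
  refine (continuousOn_integral_of_compact_support (f := fun x g => f (g * x)) hk
    (by fun_prop) fun x g hx hg => ?_).continuousAt hVx
  by_contra h
  exact hg ⟨(g * x, x), ⟨subset_tsupport f h, hx⟩, by simp⟩

theorem continuous_modularReal : Continuous (modularReal : G → ℝ) := by
  borelize G
  let μ : Measure G := Measure.haar
  obtain ⟨⟨f, hf⟩, hc, h0, h1⟩ : ∃ f : C(G, ℝ), HasCompactSupport f ∧ 0 ≤ (f : G → ℝ) ∧ f 1 ≠ 0 :=
    exists_continuous_nonneg_pos 1
  have hpos : ∫ g, f g ∂μ ≠ 0 :=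
    (hf.integral_pos_of_hasCompactSupport_nonneg_nonzero hc h0 h1).ne'
  have : (modularReal : G → ℝ) = fun x => (∫ g, f (g * x) ∂μ) / ∫ g, f g ∂μ := by
    funext x
    rw [integral_mul_right_eq μ hf hc, mul_div_cancel_right₀ _ hpos]
  rw [this]
  exact (continuous_integral_mul_right μ hf hc).div_const _

/-- The right translate `a ⋆ δ_x` of `a`, normalised to have the same integral. -/
def rightTranslate (a : C_c(G, ℝ)) (x : G) : C_c(G, ℝ) where
  toFun g := modularReal x * a (g * x⁻¹)
  continuous_toFun := by
    have := a.continuous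
    fun_prop
  hasCompactSupport' :=
    (a.hasCompactSupport.comp_homeomorph (Homeomorph.mulRight x⁻¹)).mul_left

theorem rightTranslate_apply (a : C_c(G, ℝ)) (x g : G) :
    rightTranslate a x g = modularReal x * a (g * x⁻¹) := rfl

theorem integral_rightTranslate_mul (a : C_c(G, ℝ)) (x : G) {k : G → ℝ} (hk : Continuous k) :
    ∫ g, rightTranslate a x g * k g ∂μ = ∫ g, a g * k (g * x) ∂μ := by
  have h := integral_mul_right_eq μ (f := fun g => rightTranslate a x g * k g)
    ((rightTranslate a x).continuous.mul hk) (rightTranslate a x).hasCompactSupport.mul_right x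
  rw [← mul_right_inj' (modularReal_pos x).ne', ← h, ← integral_const_mul]
  refine integral_congr_ae (Eventually.of_forall fun g => ?_)
  simp [rightTranslate_apply, mul_assoc]

theorem norm_ccToL1_rightTranslate_sub (a : C_c(G, ℝ)) (u x : G) :
    ‖ccToL1 μ (rightTranslate a (u * x)) - ccToL1 μ (rightTranslate a x)‖ =
      ∫ g, |modularReal u * a (g * u⁻¹) - a g| ∂μ := by
  rw [norm_ccToL1_sub]
  have h := integral_mul_right_eq μ
    (f := fun g => |rightTranslate a (u * x) g - rightTranslate a x g|)
    (((rightTranslate a (u * x)).continuous.sub (rightTranslate a x).continuous).abs)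
    (((rightTranslate a (u * x)).hasCompactSupport.sub
      (rightTranslate a x).hasCompactSupport).comp_left (g := fun r : ℝ => |r|) abs_zero) x
  rw [← mul_right_inj' (modularReal_pos x).ne', ← h, ← integral_const_mul]
  refine integral_congr_ae (Eventually.of_forall fun g => ?_)
  simp only [rightTranslate_apply, modularReal_mul, mul_inv_rev, mul_assoc, mul_inv_cancel_left,
    mul_inv_cancel, mul_one]
  rw [mul_left_comm, ← mul_sub, abs_mul, abs_of_pos (modularReal_pos x)]

theorem tendsto_integral_rightTranslate_sub (a : C_c(G, ℝ)) :
    Tendsto (fun u => ∫ g, |modularReal u * a (g * u⁻¹) - a g| ∂μ) (𝓝 1) (𝓝 0) := by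
  obtain ⟨V, hV, hV1⟩ := exists_compact_mem_nhds (1 : G)
  have hk : IsCompact ((fun p : G × G => p.1 * p.2) '' (tsupport a ×ˢ V)) :=
    (IsCompact.prod a.hasCompactSupport hV).image (by fun_prop)
  have ha := a.continuous
  have hm : Continuous (modularReal : G → ℝ) := continuous_modularReal
  have h := (continuousOn_integral_of_compact_support (μ := μ)
    (f := fun u g => |modularReal u * a (g * u⁻¹) - a g|) hk
    (Continuous.continuousOn (by
      change Continuous fun p : G × G => |modularReal p.1 * a (p.2 * p.1⁻¹) - a p.2|
      fun_prop)) fun u g hu hg => ?_).continuousAt hV1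
  · have h' := h.tendsto
    simpa [modularReal_one] using h'
  · have h1 : a (g * u⁻¹) = 0 := by
      by_contra h
      exact hg ⟨(g * u⁻¹, u), ⟨subset_tsupport a h, hu⟩, by simp⟩
    have h2 : a g = 0 := by
      by_contra h
      exact hg ⟨(g, 1), ⟨subset_tsupport a h, mem_of_mem_nhds hV1⟩, by simp⟩
    simp [h1, h2]

theorem norm_ccToL1_rightTranslate (a : C_c(G, ℝ)) (x : G) :
    ‖ccToL1 μ (rightTranslate a x)‖ = ‖ccToL1 μ a‖ := by
  rw [norm_ccToL1, norm_ccToL1]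
  have h := integral_mul_right_eq μ (f := fun g => |rightTranslate a x g|)
    (rightTranslate a x).continuous.abs
    ((rightTranslate a x).hasCompactSupport.comp_left (g := fun r : ℝ => |r|) abs_zero) x
  rw [← mul_right_inj' (modularReal_pos x).ne', ← h, ← integral_const_mul]
  refine integral_congr_ae (Eventually.of_forall fun g => ?_)
  simp [rightTranslate_apply, abs_mul, abs_of_pos (modularReal_pos x)]

theorem continuous_ccToL1_rightTranslate (a : C_c(G, ℝ)) :
    Continuous fun x => ccToL1 μ (rightTranslate a x) := by
  rw [continuous_iff_continuousAt]
  intro x₀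
  rw [ContinuousAt, tendsto_iff_norm_sub_tendsto_zero]
  have h1 : Tendsto (fun x => x * x₀⁻¹) (𝓝 x₀) (𝓝 1) := by
    have : Continuous fun x => x * x₀⁻¹ := by fun_prop
    simpa using this.tendsto x₀
  refine ((tendsto_integral_rightTranslate_sub μ a).comp h1).congr fun x => ?_
  have := norm_ccToL1_rightTranslate_sub μ a (x * x₀⁻¹) x₀
  rw [inv_mul_cancel_right] at this
  exact this.symm

/-- Integration against bounded continuous functions separates the points of `L¹(G)`. -/
theorem eq_of_toDual_eq {c d : Lp ℝ 1 μ} (h : ∀ k : G →ᵇ ℝ, toDual μ k c = toDual μ k d) :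
    c = d := by
  rw [← sub_eq_zero, ← norm_le_zero_iff]
  refine le_of_forall_pos_le_add fun ε hε => ?_
  rw [zero_add]
  obtain ⟨_, ⟨f, rfl⟩, hf⟩ := Metric.mem_closure_iff.1 (denseRange_ccToL1 μ (c - d)) (ε / 3)
    (by positivity)
  rw [dist_eq_norm] at hf
  -- test against `k = f / (|f| + δ)`, a continuous approximation of the sign of `f`
  have hμ : μ (tsupport f) < ∞ := f.hasCompactSupport.measure_lt_top
  set M := (μ (tsupport f)).toReal with hM
  have hM0 : 0 ≤ M := ENNReal.toReal_nonneg
  set δ := ε / (3 * (M + 1)) with hδ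
  have hδ0 : 0 < δ := by positivity
  have hfc := f.continuous
  have hk1 : ∀ g, ‖f g / (|f g| + δ)‖ ≤ 1 := fun g => by
    rw [norm_div, Real.norm_eq_abs, Real.norm_of_nonneg (by positivity), div_le_one (by positivity)]
    linarith
  let k : G →ᵇ ℝ := BoundedContinuousFunction.ofNormedAddCommGroup (fun g => f g / (|f g| + δ))
    (hfc.div (by fun_prop) fun g => by positivity) 1 hk1
  have hk : ‖k‖ ≤ 1 := BoundedContinuousFunction.norm_ofNormedAddCommGroup_le _ zero_le_one _
  have hkz : toDual μ k (c - d) = 0 := by rw [map_sub, h k, sub_self]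
  have h1 : toDual μ k (ccToL1 μ f) ≤ ε / 3 := by
    have : toDual μ k (ccToL1 μ f) = -toDual μ k (c - d - ccToL1 μ f) := by
      rw [map_sub, hkz]; ring
    rw [this]
    refine (le_abs_self _).trans ?_
    rw [abs_neg]
    refine ((toDual μ k).le_opNorm _).trans ?_
    rw [norm_toDual_bcf]
    exact (mul_le_of_le_one_left (norm_nonneg _) hk).trans hf.le
  have h2 : ‖ccToL1 μ f‖ ≤ toDual μ k (ccToL1 μ f) + δ * M := by
    rw [norm_ccToL1, toDual_ccToL1]
    have hi : Integrable (fun g => f g * k g) μ := integrable_cc_smul μ f k.continuous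
    have hind : Integrable ((tsupport f).indicator fun _ => δ) μ :=
      (integrable_indicator_iff (isClosed_tsupport f).measurableSet).2
        (integrableOn_const hμ.ne)
    have hδM : δ * M = ∫ g, (tsupport f).indicator (fun _ => δ) g ∂μ := by
      rw [integral_indicator_const _ (isClosed_tsupport f).measurableSet, smul_eq_mul, mul_comm]
      rfl
    rw [hδM, ← integral_add hi hind]
    refine integral_mono_of_nonneg (Eventually.of_forall fun g => abs_nonneg _) (hi.add hind)
      (Eventually.of_forall fun g => ?_)
    change |f g| ≤ f g * (f g / (|f g| + δ)) + (tsupport f).indicator (fun _ => δ) g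
    by_cases hg : g ∈ tsupport f
    · rw [Set.indicator_of_mem hg, mul_div_assoc', ← sub_le_iff_le_add,
        le_div_iff₀ (by positivity)]
      nlinarith [abs_mul_abs_self (f g)]
    · rw [Set.indicator_of_notMem hg, image_eq_zero_of_notMem_tsupport hg]
      simp
  have h3 : δ * M ≤ ε / 3 := by
    rw [hδ, div_mul_eq_mul_div, div_le_div_iff₀ (by positivity) (by positivity)]
    nlinarith
  have h4 : ‖c - d‖ ≤ ‖c - d - ccToL1 μ f‖ + ‖ccToL1 μ f‖ := by
    simpa using norm_add_le (c - d - ccToL1 μ f) (ccToL1 μ f)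
  linarith

/-- Convolution as an average of right translates: `a ⋆ b = ∫ b(x) (a ⋆ δ_x) dx`. -/
theorem convolutionL1_ccToL1 (a b : C_c(G, ℝ)) :
    convolutionL1 μ (ccToL1 μ a) (ccToL1 μ b) =
      ∫ x, b x • ccToL1 μ (rightTranslate a x) ∂μ := by
  refine eq_of_toDual_eq μ fun k => ?_
  rw [convolutionL1_apply, integral_ccToL1_smul]
  rw [← (toDual μ k).integral_comp_comm
      (integrable_cc_smul μ a (continuous_translateL1 μ (ccToL1 μ b))),
    ← (toDual μ k).integral_comp_comm
      (integrable_cc_smul μ b (continuous_ccToL1_rightTranslate μ a))]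
  have hl : ∀ h, toDual μ k (a h • translateL1 μ h (ccToL1 μ b)) =
      ∫ x, a h * (b x * k (h * x)) ∂μ := by
    intro h
    have := congrArg (fun ψ : StrongDual ℝ (Lp ℝ 1 μ) => ψ (ccToL1 μ b)) (toDual_translateBCF μ k h)
    change toDual μ (translateBCF k h) (ccToL1 μ b) = toDual μ k (translateL1 μ h (ccToL1 μ b))
      at this
    rw [map_smul, ← this, toDual_ccToL1, smul_eq_mul, ← integral_const_mul]
    rfl
  have hr : ∀ x, toDual μ k (b x • ccToL1 μ (rightTranslate a x)) =
      ∫ h, a h * (b x * k (h * x)) ∂μ := by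
    intro x
    rw [map_smul, toDual_ccToL1, integral_rightTranslate_mul μ a x k.continuous, smul_eq_mul,
      ← integral_const_mul]
    simp only [mul_left_comm]
  simp only [hl, hr]
  have ha := a.continuous
  have hb := b.continuous
  have hk := k.continuous
  refine integral_integral_swap_of_hasCompactSupport ?_ ?_
  · change Continuous fun p : G × G => a p.1 * (b p.2 * k (p.1 * p.2))
    fun_prop
  · refine HasCompactSupport.intro
      (IsCompact.prod a.hasCompactSupport b.hasCompactSupport) fun p hp => ?_
    change a p.1 * (b p.2 * k (p.1 * p.2)) = 0
    by_cases h : p.1 ∈ tsupport a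
    · rw [image_eq_zero_of_notMem_tsupport fun h' => hp ⟨h, h'⟩, zero_mul, mul_zero]
    · rw [image_eq_zero_of_notMem_tsupport h, zero_mul]

/-- For `a ∈ C_c(G)` the functional `φ · a` is the function `x ↦ φ(a ⋆ δ_x)`, which is right uniformly
continuous because `‖a ⋆ δ_u ⋆ δ_x - a ⋆ δ_x‖ = ‖a ⋆ δ_u - a‖` for all `x`. -/
theorem dualAct_ccToL1_mem (φ : StrongDual ℝ (Lp ℝ 1 μ)) (a : C_c(G, ℝ)) :
    dualAct (convolutionL1 μ) φ (ccToL1 μ a) ∈ toDual μ '' rucFunctions G := by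
  let F : G →ᵇ ℝ := BoundedContinuousFunction.ofNormedAddCommGroup
    (fun x => φ (ccToL1 μ (rightTranslate a x)))
    (φ.continuous.comp (continuous_ccToL1_rightTranslate μ a)) (‖φ‖ * ‖ccToL1 μ a‖) fun x => by
      rw [← norm_ccToL1_rightTranslate μ a x]
      exact φ.le_opNorm _
  refine ⟨F, fun ε hε => ?_, ?_⟩
  · have h : ∀ᶠ u in 𝓝 (1 : G), ‖φ‖ * ∫ g, |modularReal u * a (g * u⁻¹) - a g| ∂μ < ε := by
      have := (tendsto_integral_rightTranslate_sub μ a).const_mul ‖φ‖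
      rw [mul_zero] at this
      exact this.eventually_lt_const hε
    refine ⟨_, h, fun x y hxy => lt_of_le_of_lt ?_ hxy⟩
    change |φ (ccToL1 μ (rightTranslate a x)) - φ (ccToL1 μ (rightTranslate a y))| ≤ _
    have := norm_ccToL1_rightTranslate_sub μ a (x * y⁻¹) y
    rw [inv_mul_cancel_right] at this
    rw [← map_sub, ← this]
    exact φ.le_opNorm _
  · refine DFunLike.coe_injective ((denseRange_ccToL1 μ).equalizer (map_continuous _)
      (map_continuous _) (funext fun b => ?_))
    change toDual μ F (ccToL1 μ b) = φ (convolutionL1 μ (ccToL1 μ a) (ccToL1 μ b))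
    rw [convolutionL1_ccToL1, ← φ.integral_comp_comm
      (integrable_cc_smul μ b (continuous_ccToL1_rightTranslate μ a)), toDual_ccToL1]
    simp only [map_smul]
    rfl

variable (G) in
/-- `RUC(G)` as a subspace of `C_b(G)`. -/
def rucSubmodule : Submodule ℝ (G →ᵇ ℝ) where
  carrier := rucFunctions G
  add_mem' {f f'} hf hf' ε hε := by
    obtain ⟨U, hU, h⟩ := hf (ε / 2) (half_pos hε)
    obtain ⟨U', hU', h'⟩ := hf' (ε / 2) (half_pos hε)
    refine ⟨U ∩ U', inter_mem hU hU', fun x y hxy => ?_⟩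
    have h1 := h x y hxy.1
    have h2 := h' x y hxy.2
    change |f x + f' x - (f y + f' y)| < ε
    rw [abs_lt] at *
    constructor <;> linarith
  zero_mem' ε hε := ⟨Set.univ, univ_mem, fun x y _ => by simpa using hε⟩
  smul_mem' c f hf ε hε := by
    obtain ⟨U, hU, h⟩ := hf (ε / (|c| + 1)) (by positivity)
    refine ⟨U, hU, fun x y hxy => ?_⟩
    change |c * f x - c * f y| < ε
    rw [← mul_sub, abs_mul]
    have h1 := h x y hxy
    rw [lt_div_iff₀ (by positivity)] at h1
    nlinarith [abs_nonneg (f x - f y), abs_nonneg c]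

variable (G) in
theorem isClosed_rucFunctions : IsClosed (rucFunctions G) := by
  refine isClosed_of_closure_subset fun f hf ε hε => ?_
  obtain ⟨f', hf', hd⟩ := Metric.mem_closure_iff.1 hf (ε / 3) (by positivity)
  obtain ⟨U, hU, h⟩ := hf' (ε / 3) (by positivity)
  refine ⟨U, hU, fun x y hxy => ?_⟩
  have h1 := h x y hxy
  have h2 := (f.dist_coe_le_dist (g := f') x).trans_lt hd
  have h3 := (f.dist_coe_le_dist (g := f') y).trans_lt hd
  rw [Real.dist_eq] at h2 h3
  rw [abs_lt] at *
  constructor <;> linarith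

theorem wapFunctionals_subset_image_rucFunctions :
    wapFunctionals (convolutionL1 μ) ⊆ toDual μ '' rucFunctions G := fun φ hφ =>
  mem_of_mem_wapFunctionals μ hφ
    ((rucSubmodule G).convex.linear_image (toDualLI μ).toLinearMap)
    ((toDualLI μ).isometry.isClosedEmbedding.isClosedMap _ (isClosed_rucFunctions G))
    (dualAct_ccToL1_mem μ φ)

/-- The orbit `f · G` lies in the weak closure of `f · B` when that closure is weakly compact. -/
theorem isRelWeaklyCompact_toDual_image_groupOrbit {f : G →ᵇ ℝ}
    (hf : toDual μ f ∈ wapFunctionals (convolutionL1 μ)) :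
    IsRelWeaklyCompact (toDual μ '' groupOrbit f) := by
  refine IsCompact.of_isClosed_subset hf isClosed_closure (closure_minimal ?_ isClosed_closure)
  rintro _ ⟨_, ⟨_, ⟨h, rfl⟩, rfl⟩, rfl⟩
  rw [toDual_translateBCF]
  refine closure_mono (Set.image_mono (Set.image_mono fun e he => ?_))
    (comp_translateL1_mem_closure μ hf h)
  exact mem_closedBall_zero_iff.2 (norm_le_one_of_mem_densities μ he)

end Group

end

theorem corollary4 {G : Type*} [Group G] [TopologicalSpace G] [IsTopologicalGroup G]
    [LocallyCompactSpace G] [T2Space G] [MeasurableSpace G] [BorelSpace G]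
    (μ : Measure G) [μ.IsHaarMeasure] [μ.Regular] :
    wapFunctionals (convolutionL1 μ) =
        algebraSmall (convolutionL1 μ) (dlpSmall (StrongDual ℝ (Lp ℝ 1 μ))) ∧
      algebraSmall (convolutionL1 μ) (dlpSmall (StrongDual ℝ (Lp ℝ 1 μ))) =
        groupSmall μ (dlpSmall (StrongDual ℝ (Lp ℝ 1 μ))) ∧
      groupSmall μ (dlpSmall (StrongDual ℝ (Lp ℝ 1 μ))) =
        toDual μ '' wapFunctions G := by
  rw [dlpSmall_eq]
  have h1 : wapFunctionals (convolutionL1 μ) =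
      algebraSmall (convolutionL1 μ) {S | IsRelWeaklyCompact S} :=
    Set.Subset.antisymm (fun φ hφ => ⟨wapFunctionals_subset_rucFunctionals μ hφ, hφ⟩)
      fun φ hφ => hφ.2
  have h2 : wapFunctionals (convolutionL1 μ) ⊆ groupSmall μ {S | IsRelWeaklyCompact S} := by
    intro φ hφ
    obtain ⟨f, hf, rfl⟩ := wapFunctionals_subset_image_rucFunctions μ hφ
    exact ⟨f, ⟨hf, isRelWeaklyCompact_toDual_image_groupOrbit μ hφ⟩, rfl⟩
  have h3 : groupSmall μ {S | IsRelWeaklyCompact S} ⊆ toDual μ '' wapFunctions G := by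
    rintro _ ⟨f, ⟨-, hf⟩, rfl⟩
    exact ⟨f, IsRelWeaklyCompact.of_image (toDualLI μ) hf, rfl⟩
  have h4 : toDual μ '' wapFunctions G ⊆ wapFunctionals (convolutionL1 μ) := by
    rintro _ ⟨f, hf, rfl⟩
    exact toDual_mem_wapFunctionals μ
      (IsRelWeaklyCompact.image hf (toDualLI μ).toContinuousLinearMap)
  rw [← h1]
  exact ⟨rfl, h2.antisymm (h3.trans h4), h3.antisymm (h4.trans h2)⟩
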